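/- **Theorem 4.8.** Let $(M,g)$ be a Riemannian manifold with Levi-Civita connection $\widetilde\nabla$, let $\mu\in\{-1,+1\}$, and let $F$ be a smooth $(1,1)$-tensor field on $M$ with $g(FX,Y)+\mu\, g(X,FY)=0$ for all $X,Y$. Assume that $F$ is nondegenerate at every point and parallel, $\widetilde\nabla F=0$. Let $N$ be an (immersed) submanifold of $M$ with the induced metric, Levi-Civita connection $\nabla$, second fundamental form $h$ (the normal part of $\widetilde\nabla_XY$) and Weingarten operators $A_V$ ($-A_VX$ is the tangential part of $\widetilde\nabla_XV$, for $V$ a normal field). Assume that $N$ is semi-invariant: there is a smooth distribution $D$ on $N$ such that $F(D)\subseteq D$, the orthogonal complement $D^\perp$ of $D$ in $TN$ satisfies $F(D^\perp)\subseteq T^\perp N$, and $F^2(D^\perp)$ is a distribution on $N$; fix such a $D$. Let $\widetilde D$ be the orthogonal complement of $F(D^\perp)$ in $T^\perp N$. Then the following are equivalent: (i) the $F$-anti-invariant foliation is totally geodesic, that is, $D^\perp$ is integrable (closed under the Lie bracket) and $\nabla_YZ\in\Gamma(D^\perp)$ for all $Y,Z\in\Gamma(D^\perp)$; (ii) $h(X,Y)\in\Gamma(\widetilde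 D)$ for all $X\in\Gamma(D)$ and $Y\in\Gamma(D^\perp)$; (iii) $D^\perp$ is $A_V$-invariant for every $V\in\Gamma(F(D^\perp))$, that is, $A_VY\in\Gamma(D^\perp)$ for all $Y\in\Gamma(D^\perp)$. -/

import Mathlib

open Bundle Manifold ContDiff VectorField

noncomputable section

/-! ### Smooth fields and the Levi-Civita connection of a Riemannian manifold -/

section LeviCivita

variable {E : Type*} [NormedAddCommGroup E] [NormedSpace ℝ E]
  {H : Type*} [TopologicalSpace H] {I : ModelWithCorners ℝ E H}
  {M : Type*} [TopologicalSpace M] [ChartedSpace H M] [IsManifold I ∞ M]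

/-- A smooth Riemannian metric on the manifold `M`. -/
abbrev RiemMetric (I : ModelWithCorners ℝ E H) (M : Type*) [TopologicalSpace M] [ChartedSpace H M]
    [IsManifold I ∞ M] :=
  ContMDiffRiemannianMetric I ∞ E (TangentSpace I : M → Type _)

variable (g : RiemMetric I M)

theorem mdifferentiableAt_metric {X Y : ∀ x : M, TangentSpace I x} {x : M}
    (hX : MDiffAt (T% X) x) (hY : MDiffAt (T% Y) x) :
    MDiffAt (fun y => g.inner y (X y) (Y y)) x := by
  have : MDifferentiableAt I (I.prod 𝓘(ℝ))
      (fun m ↦ TotalSpace.mk' ℝ (E := Bundle.Trivial M ℝ) m (g.inner m (X m) (Y m))) x := by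
    apply MDifferentiableAt.clm_bundle_apply₂ (F₁ := E) (F₂ := E)
    · exact g.contMDiff.mdifferentiableAt (by simp)
    · exact hX
    · exact hY
  simp only [mdifferentiableAt_totalSpace] at this
  exact this.2

/-- The right-hand side of the Koszul formula for `2 g(∇_X Y, Z)`. -/
def koszul (X Y Z : ∀ x : M, TangentSpace I x) (x : M) : ℝ :=
  mvfderiv I (fun y => g.inner y (Y y) (Z y)) x (X x)
    + mvfderiv I (fun y => g.inner y (X y) (Z y)) x (Y x)
    - mvfderiv I (fun y => g.inner y (X y) (Y y)) x (Z x)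
    + g.inner x (mlieBracket I X Y x) (Z x)
    - g.inner x (mlieBracket I X Z x) (Y x)
    - g.inner x (mlieBracket I Y Z x) (X x)

theorem metric_ext {x : M} {v w : TangentSpace I x}
    (h : ∀ z, g.inner x v z = g.inner x w z) : v = w := by
  by_contra hne
  have h1 := g.pos x (v - w) (sub_ne_zero.2 hne)
  have h2 : g.inner x (v - w) (v - w) = g.inner x v (v - w) - g.inner x w (v - w) := by
    rw [map_sub (g.inner x), sub_apply]
  linarith [h (v - w)]

theorem metric_neg_left {x : M} (v w : TangentSpace I x) :
    g.inner x (-v) w = -g.inner x v w := by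
  have h := congrArg (fun L => L w) ((g.inner x).map_add (-v) v)
  simp only [neg_add_cancel, map_zero, add_apply, zero_apply] at h
  linarith

variable [FiniteDimensional ℝ E]

theorem koszul_tensorial_left {Y Z : ∀ x : M, TangentSpace I x} {x : M}
    (hY : MDiffAt (T% Y) x) (hZ : MDiffAt (T% Z) x) :
    TensorialAt I E (fun X => koszul g X Y Z x) x where
  smul {f X} hf hX := by
    simp only [koszul, Pi.smul_apply', map_smul, smul_eq_mul, smul_apply,
      mvfderiv_fun_mul hf (mdifferentiableAt_metric g hX hY),
      mvfderiv_fun_mul hf (mdifferentiableAt_metric g hX hZ),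
      mlieBracket_smul_left hf hX, map_add, add_apply]
    ring
  add {X X'} hX hX' := by
    simp only [koszul, Pi.add_apply, map_add, add_apply,
      mvfderiv_fun_add (mdifferentiableAt_metric g hX hY) (mdifferentiableAt_metric g hX' hY),
      mvfderiv_fun_add (mdifferentiableAt_metric g hX hZ) (mdifferentiableAt_metric g hX' hZ),
      mlieBracket_add_left hX hX']
    ring

theorem koszul_tensorial_right {X Y : ∀ x : M, TangentSpace I x} {x : M}
    (hX : MDiffAt (T% X) x) (hY : MDiffAt (T% Y) x) :
    TensorialAt I E (fun Z => koszul g X Y Z x) x where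
  smul {f Z} hf hZ := by
    simp only [koszul, Pi.smul_apply', map_smul, smul_eq_mul, smul_apply,
      mvfderiv_fun_mul hf (mdifferentiableAt_metric g hX hZ),
      mvfderiv_fun_mul hf (mdifferentiableAt_metric g hY hZ),
      mlieBracket_smul_right hf hZ, map_add, add_apply]
    rw [g.symm x (Z x) (Y x), g.symm x (Z x) (X x)]
    ring
  add {Z Z'} hZ hZ' := by
    simp only [koszul, Pi.add_apply, map_add, add_apply,
      mvfderiv_fun_add (mdifferentiableAt_metric g hX hZ) (mdifferentiableAt_metric g hX hZ'),
      mvfderiv_fun_add (mdifferentiableAt_metric g hY hZ) (mdifferentiableAt_metric g hY hZ'),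
      mlieBracket_add_right hZ hZ']
    ring

theorem koszul_add_mid {X Y Y' Z : ∀ x : M, TangentSpace I x} {x : M}
    (hX : MDiffAt (T% X) x) (hY : MDiffAt (T% Y) x) (hY' : MDiffAt (T% Y') x)
    (hZ : MDiffAt (T% Z) x) :
    koszul g X (Y + Y') Z x = koszul g X Y Z x + koszul g X Y' Z x := by
  simp only [koszul, Pi.add_apply, map_add, add_apply,
    mvfderiv_fun_add (mdifferentiableAt_metric g hX hY) (mdifferentiableAt_metric g hX hY'),
    mvfderiv_fun_add (mdifferentiableAt_metric g hY hZ) (mdifferentiableAt_metric g hY' hZ),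
    mlieBracket_add_left hY hY', mlieBracket_add_right hY hY']
  ring

theorem koszul_smul_mid {f : M → ℝ} {X Y Z : ∀ x : M, TangentSpace I x} {x : M}
    (hf : MDiffAt f x) (hX : MDiffAt (T% X) x) (hY : MDiffAt (T% Y) x)
    (hZ : MDiffAt (T% Z) x) :
    koszul g X (f • Y) Z x
      = f x * koszul g X Y Z x + 2 * (mvfderiv I f x (X x) * g.inner x (Y x) (Z x)) := by
  simp only [koszul, Pi.smul_apply', map_smul, smul_eq_mul, smul_apply,
    mvfderiv_fun_mul hf (mdifferentiableAt_metric g hX hY),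
    mvfderiv_fun_mul hf (mdifferentiableAt_metric g hY hZ),
    mlieBracket_smul_left hf hY, mlieBracket_smul_right hf hY, map_add, add_apply]
  rw [g.symm x (X x) (Y x)]
  ring

theorem exists_metric_repr {x : M} (B : TangentSpace I x →L[ℝ] TangentSpace I x →L[ℝ] ℝ) :
    ∃ A : TangentSpace I x →L[ℝ] TangentSpace I x, ∀ v w, g.inner x (A v) w = B v w := by
  have : FiniteDimensional ℝ (TangentSpace I x) := inferInstanceAs (FiniteDimensional ℝ E)
  have : T2Space (TangentSpace I x) := inferInstanceAs (T2Space E)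
  let L : TangentSpace I x →ₗ[ℝ] Module.Dual ℝ (TangentSpace I x) :=
    { toFun v := (g.inner x v).toLinearMap
      map_add' v w := by ext; simp
      map_smul' c v := by ext; simp }
  have hL : Function.Injective L := by
    rw [← LinearMap.ker_eq_bot, LinearMap.ker_eq_bot']
    intro v hv
    by_contra h
    have h1 := g.pos x v h
    have h2 : g.inner x v v = 0 := LinearMap.congr_fun hv v
    linarith
  let e := LinearMap.linearEquivOfInjective L hL (Subspace.dual_finrank_eq).symm
  let B' : TangentSpace I x →ₗ[ℝ] Module.Dual ℝ (TangentSpace I x) :=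
    { toFun v := (B v).toLinearMap
      map_add' v w := by ext; simp
      map_smul' c v := by ext; simp }
  refine ⟨LinearMap.toContinuousLinearMap (e.symm.toLinearMap ∘ₗ B'), fun v w => ?_⟩
  have : L (e.symm (B' v)) = B' v := by
    change e (e.symm (B' v)) = B' v
    simp
  exact LinearMap.congr_fun this w

/-- `∇` is a Levi-Civita connection of `g`: it is torsion-free and
`v (g(X, Y)) = g(∇_v X, Y) + g(X, ∇_v Y)`. -/
structure IsLeviCivita (cov : CovariantDerivative I E (TangentSpace I : M → Type _)) : Prop where
  torsion_free : cov.torsion = 0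
  metric : ∀ {x : M} {X Y : ∀ y : M, TangentSpace I y}, MDiffAt (T% X) x → MDiffAt (T% Y) x →
    ∀ v : TangentSpace I x, mvfderiv I (fun y => g.inner y (X y) (Y y)) x v
      = g.inner x (cov X x v) (Y x) + g.inner x (X x) (cov Y x v)

theorem exists_isLeviCivita :
    ∃ cov : CovariantDerivative I E (TangentSpace I : M → Type _), IsLeviCivita g cov := by
  have key : ∀ (Y : ∀ y : M, TangentSpace I y) (x : M),
      ∃ A : TangentSpace I x →L[ℝ] TangentSpace I x, MDiffAt (T% Y) x →
        ∀ X Z : ∀ y : M, TangentSpace I y, MDiffAt (T% X) x → MDiffAt (T% Z) x →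
          2 * g.inner x (A (X x)) (Z x) = koszul g X Y Z x := by
    intro Y x
    by_cases hY : MDiffAt (T% Y) x
    · obtain ⟨A, hA⟩ := exists_metric_repr g ((1 / 2 : ℝ) •
        TensorialAt.mkHom₂ (fun X Z => koszul g X Y Z x) x
          (fun Z hZ => koszul_tensorial_left g hY hZ)
          (fun X hX => koszul_tensorial_right g hX hY))
      refine ⟨A, fun _ X Z hX hZ => ?_⟩
      rw [hA, smul_apply, smul_apply,
        TensorialAt.mkHom₂_apply (fun Z hZ => koszul_tensorial_left g hY hZ)
          (fun X hX => koszul_tensorial_right g hX hY) hX hZ, smul_eq_mul]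
      ring
    · exact ⟨0, fun h => absurd h hY⟩
  choose D hD using key
  have hext : ∀ {x : M} (v : TangentSpace I x),
      MDiffAt (T% (FiberBundle.extend E v)) x := fun v => FiberBundle.mdifferentiableAt_extend ..
  let cov : CovariantDerivative I E (TangentSpace I : M → Type _) :=
    { toFun := D
      isCovariantDerivativeOnUniv :=
        { add := by
            intro Y Y' x hY hY' _
            ext1 v
            refine metric_ext g fun z => ?_
            have h0 := hD _ x (mdifferentiableAt_add_section hY hY') _ _ (hext v) (hext z)
            have h1 := hD _ x hY _ _ (hext v) (hext z)
            have h2 := hD _ x hY' _ _ (hext v) (hext z)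
            have h3 := koszul_add_mid g (hext v) hY hY' (hext z)
            simp only [FiberBundle.extend_apply_self] at h0 h1 h2
            rw [add_apply, map_add, add_apply]
            change 2 * g.inner x (D (Y + Y') x v) z = _ at h0
            linarith
          leibniz := by
            intro Y f x hY hf _
            ext1 v
            refine metric_ext g fun z => ?_
            have h0 := hD _ x (hf.smul_section hY) _ _ (hext v) (hext z)
            have h1 := hD _ x hY _ _ (hext v) (hext z)
            have h3 := koszul_smul_mid g hf (hext v) hY (hext z)
            simp only [FiberBundle.extend_apply_self] at h0 h1 h3
            change 2 * g.inner x (D (f • Y) x v) z = _ at h0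
            simp only [add_apply, map_add, smul_apply, map_smul, smul_eq_mul,
              ContinuousLinearMap.smulRight_apply]
            change _ = koszul g _ (f • Y) _ x at h0
            rw [h3, ← h1] at h0
            linarith } }
  refine ⟨cov, (cov.torsion_eq_zero_iff).2 ?_, ?_⟩
  · intro X Y x hX hY
    refine metric_ext g fun z => ?_
    have h1 := hD _ x hY _ _ hX (hext z)
    have h2 := hD _ x hX _ _ hY (hext z)
    simp only [FiberBundle.extend_apply_self] at h1 h2
    rw [map_sub, sub_apply]
    change g.inner x (D Y x (X x)) z - g.inner x (D X x (Y x)) z = _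
    simp only [koszul, FiberBundle.extend_apply_self] at h1 h2
    have e1 : (fun y => g.inner y (Y y) (X y)) = fun y => g.inner y (X y) (Y y) :=
      funext fun y => g.symm y _ _
    rw [mlieBracket_swap_apply (V := Y) (W := X), e1, metric_neg_left] at h2
    linarith
  · intro x X Y hX hY v
    have h1 := hD _ x hX _ _ (hext v) hY
    have h2 := hD _ x hY _ _ (hext v) hX
    simp only [koszul, FiberBundle.extend_apply_self] at h1 h2
    have e1 : (fun y => g.inner y (Y y) (X y)) = fun y => g.inner y (X y) (Y y) :=
      funext fun y => g.symm y _ _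
    rw [mlieBracket_swap_apply (V := Y) (W := X), e1, metric_neg_left] at h2
    change _ = g.inner x (D X x v) (Y x) + g.inner x (X x) (D Y x v)
    rw [g.symm x (X x)]
    linarith

/-- The Levi-Civita connection of `g`; `leviCivita g Y x v` is `∇_v Y` at `x`. -/
def leviCivita : CovariantDerivative I E (TangentSpace I : M → Type _) :=
  (exists_isLeviCivita g).choose

theorem leviCivita_spec : IsLeviCivita g (leviCivita g) := (exists_isLeviCivita g).choose_spec

/-- The `g`-orthogonal complement of a subspace `W` of a tangent space. -/
def gOrth {E : Type*} [NormedAddCommGroup E] [NormedSpace ℝ E]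
    {H : Type*} [TopologicalSpace H] {I : ModelWithCorners ℝ E H}
    {M : Type*} [TopologicalSpace M] [ChartedSpace H M] [IsManifold I ∞ M]
    (g : RiemMetric I M) {x : M} (W : Submodule ℝ (TangentSpace I x)) :
    Submodule ℝ (TangentSpace I x) where
  carrier := {v | ∀ w ∈ W, g.inner x v w = 0}
  add_mem' {a b} ha hb w hw := by rw [map_add, add_apply, ha w hw, hb w hw, add_zero]
  zero_mem' w _ := by rw [map_zero, zero_apply]
  smul_mem' c v hv w hw := by rw [map_smul, smul_apply, hv w hw, smul_zero]

theorem exists_orthogonal_part {x : M} (W : Submodule ℝ (TangentSpace I x))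
    (v : TangentSpace I x) : ∃ w : TangentSpace I x, w ∈ W ∧ v - w ∈ gOrth g W := by
  have : FiniteDimensional ℝ (TangentSpace I x) := inferInstanceAs (FiniteDimensional ℝ E)
  let L : W →ₗ[ℝ] Module.Dual ℝ W :=
    { toFun u := (g.inner x u).toLinearMap ∘ₗ W.subtype
      map_add' u w := by ext; simp
      map_smul' c u := by ext; simp }
  have hL : Function.Injective L := by
    rw [← LinearMap.ker_eq_bot, LinearMap.ker_eq_bot']
    intro u hu
    by_contra h
    have h1 := g.pos x u (fun h0 => h (Subtype.ext h0))
    have h2 : g.inner x u u = 0 := LinearMap.congr_fun hu u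
    linarith
  let e := LinearMap.linearEquivOfInjective L hL (Subspace.dual_finrank_eq).symm
  obtain ⟨w, hw⟩ := e.surjective ((g.inner x v).toLinearMap ∘ₗ W.subtype)
  refine ⟨w, w.2, fun u hu => ?_⟩
  have h : g.inner x w u = g.inner x v u := LinearMap.congr_fun hw ⟨u, hu⟩
  rw [map_sub (g.inner x), sub_apply, h, sub_self]

/-- The `g`-orthogonal projection of a tangent vector `v` onto the subspace `W`. -/
def orthProj {x : M} (W : Submodule ℝ (TangentSpace I x)) (v : TangentSpace I x) :
    TangentSpace I x :=
  (exists_orthogonal_part g W v).choose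

theorem orthProj_spec {x : M} (W : Submodule ℝ (TangentSpace I x)) (v : TangentSpace I x) :
    orthProj g W v ∈ W ∧ v - orthProj g W v ∈ gOrth g W :=
  (exists_orthogonal_part g W v).choose_spec

end LeviCivita

/-! ### Affinors -/

section Affinor

variable {E : Type*} [NormedAddCommGroup E] [NormedSpace ℝ E]
  {H : Type*} [TopologicalSpace H] {I : ModelWithCorners ℝ E H}
  {M : Type*} [TopologicalSpace M] [ChartedSpace H M] [IsManifold I ∞ M]

/-- `X` is a smooth vector field. -/
def IsSmoothField (X : ∀ x : M, TangentSpace I x) : Prop :=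
  ContMDiff I I.tangent ∞ (fun x => (⟨x, X x⟩ : TangentBundle I M))

/-- `(M, g, F, μ)` is a `(g, F, μ)`-manifold: `F` is a smooth `(1,1)`-tensor field on `M`,
`μ = ±1` and `g(F X, Y) + μ g(X, F Y) = 0`. -/
structure IsAffinorMetric (g : RiemMetric I M)
    (F : ∀ x : M, TangentSpace I x →L[ℝ] TangentSpace I x) (μ : ℝ) : Prop where
  sign : μ = -1 ∨ μ = 1
  smooth : ContMDiff I (I.prod 𝓘(ℝ, E →L[ℝ] E)) ∞
    (fun x => TotalSpace.mk' (E →L[ℝ] E)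
      (E := fun x : M => TangentSpace I x →L[ℝ] TangentSpace I x) x (F x))
  compat : ∀ (x : M) (v w : TangentSpace I x),
    g.inner x (F x v) w + μ * g.inner x v (F x w) = 0

/-- `F` is parallel for the Levi-Civita connection of `g`: `∇_v (F Y) = F (∇_v Y)`. -/
def IsParallel [FiniteDimensional ℝ E] (g : RiemMetric I M)
    (F : ∀ x : M, TangentSpace I x →L[ℝ] TangentSpace I x) : Prop :=
  ∀ Y : ∀ x : M, TangentSpace I x, IsSmoothField Y → ∀ (x : M) (v : TangentSpace I x),
    leviCivita g (fun y => F y (Y y)) x v = F x (leviCivita g Y x v)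

/-- `D` is a smooth distribution (a vector subbundle of the tangent bundle): near each point it is
spanned by finitely many smooth, pointwise linearly independent vector fields. -/
def IsSmoothDistribution (D : ∀ x : M, Submodule ℝ (TangentSpace I x)) : Prop :=
  ∀ x₀ : M, ∃ (U : Set M) (k : ℕ) (X : Fin k → ∀ x : M, TangentSpace I x),
    IsOpen U ∧ x₀ ∈ U ∧
    (∀ i, ContMDiffOn I I.tangent ∞ (fun x => (⟨x, X i x⟩ : TangentBundle I M)) U) ∧
    ∀ x ∈ U, LinearIndependent ℝ (fun i => X i x) ∧
      Submodule.span ℝ (Set.range fun i => X i x) = D x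

/-- `X ∈ Γ(D)`. -/
structure IsSectionOf (D : ∀ x : M, Submodule ℝ (TangentSpace I x))
    (X : ∀ x : M, TangentSpace I x) : Prop where
  smooth : IsSmoothField X
  mem : ∀ x, X x ∈ D x

/-- The orthogonal complement `D^⊥` of the distribution `D`. -/
def perp (g : RiemMetric I M) (D : ∀ x : M, Submodule ℝ (TangentSpace I x)) :
    ∀ x : M, Submodule ℝ (TangentSpace I x) :=
  fun x => gOrth g (D x)

/-- `D` defines a totally geodesic foliation: it is integrable (involutive), and the second
fundamental form of its leaves vanishes, that is, `∇_Y Z ∈ Γ(D)` for all `Y, Z ∈ Γ(D)`, where `∇`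
is the Levi-Civita connection. -/
structure IsTotallyGeodesicFoliation [FiniteDimensional ℝ E] (g : RiemMetric I M)
    (D : ∀ x : M, Submodule ℝ (TangentSpace I x)) : Prop where
  involutive : ∀ Y Z : ∀ x : M, TangentSpace I x, IsSectionOf D Y → IsSectionOf D Z →
    ∀ x, mlieBracket I Y Z x ∈ D x
  geodesic : ∀ Y Z : ∀ x : M, TangentSpace I x, IsSectionOf D Y → IsSectionOf D Z →
    ∀ x, leviCivita g Z x (Y x) ∈ D x

end Affinor

/-! ### Submanifolds -/

section Submanifold

variable {E : Type*} [NormedAddCommGroup E] [NormedSpace ℝ E]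
  {H : Type*} [TopologicalSpace H] {I : ModelWithCorners ℝ E H}
  {M : Type*} [TopologicalSpace M] [ChartedSpace H M] [IsManifold I ∞ M]
  {E' : Type*} [NormedAddCommGroup E'] [NormedSpace ℝ E']
  {H' : Type*} [TopologicalSpace H'] {J : ModelWithCorners ℝ E' H'}
  {N : Type*} [TopologicalSpace N] [ChartedSpace H' N] [IsManifold J ∞ N]

/-- `f : N → M` is an isometric immersion: `N` is a submanifold of `M` and `gN` is the metric
induced on it by `g`. -/
structure IsIsometricImmersion (g : RiemMetric I M) (gN : RiemMetric J N) (f : N → M) : Prop where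
  smooth : ContMDiff J I ∞ f
  injective : ∀ x, Function.Injective (mfderiv J I f x)
  isometric : ∀ (x : N) (v w : TangentSpace J x),
    gN.inner x v w = g.inner (f x) (mfderiv J I f x v) (mfderiv J I f x w)

variable (J) in
/-- `V` is a smooth vector field along `f`, i.e. a section of `f^* TM`. -/
def IsSmoothAlong (f : N → M) (V : ∀ x : N, TangentSpace I (f x)) : Prop :=
  ContMDiff J I.tangent ∞ (fun x => (⟨f x, V x⟩ : TangentBundle I M))

variable (J) in
/-- The connection induced by `cov` on `f^* TM`: the covariant derivative at `x`, in the direction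
`v`, of the vector field `V` along `f`. With respect to the frame `e_i` of `TM` given by the
trivialization at `f x`, and `V = ∑ V^i e_i`, it is `∑ (v V^i) e_i + ∑ V^i ∇_{df v} e_i`. -/
def covAlong (cov : CovariantDerivative I E (TangentSpace I : M → Type _)) (f : N → M)
    (V : ∀ x : N, TangentSpace I (f x)) (x : N) (v : TangentSpace J x) : TangentSpace I (f x) :=
  (trivializationAt E (TangentSpace I : M → Type _) (f x)).symm (f x)
      (mvfderiv J (fun y : N =>
        (trivializationAt E (TangentSpace I : M → Type _) (f x) ⟨f y, V y⟩).2) x v)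
    + cov (FiberBundle.extend E (V x)) (f x) (mfderiv J I f x v)

/-- On restrictions of vector fields of the ambient manifold, `covAlong` is the ambient covariant
derivative. -/
theorem covAlong_comp [FiniteDimensional ℝ E]
    (cov : CovariantDerivative I E (TangentSpace I : M → Type _)) {f : N → M}
    (W : ∀ p : M, TangentSpace I p) {x : N} (hf : MDiffAt f x) (hW : MDiffAt (T% W) (f x))
    (v : TangentSpace J x) :
    covAlong J cov f (fun y => W (f y)) x v = cov W (f x) (mfderiv J I f x v) := by
  let t := trivializationAt E (TangentSpace I : M → Type _) (f x)
  have hmem : f x ∈ t.baseSet := FiberBundle.mem_baseSet_trivializationAt' (f x)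
  have hev : ∀ᶠ p in nhds (f x), p ∈ t.baseSet := t.open_baseSet.mem_nhds hmem
  have hdiff : ∀ {σ : ∀ p : M, TangentSpace I p}, MDiffAt (T% σ) (f x) →
      MDiffAt (fun p => (t ⟨p, σ p⟩).2) (f x) := fun {σ} h => (mdifferentiableAt_section I σ).1 h
  have hcongr : ∀ {h k : M → E}, h =ᶠ[nhds (f x)] k →
      mvfderiv I h (f x) = mvfderiv I k (f x) := by
    intro h k hk
    simp only [mvfderiv, hk.mfderiv_eq]
    rfl
  have hT : TensorialAt I E (fun σ : ∀ p : M, TangentSpace I p =>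
      cov σ (f x) - t.symmL ℝ (f x) ∘L mvfderiv I (fun p => (t ⟨p, σ p⟩).2) (f x)) (f x) :=
    { add := by
        intro σ σ' hσ hσ'
        have h1 : (fun p => (t ⟨p, (σ + σ') p⟩).2) =ᶠ[nhds (f x)]
            fun p => (t ⟨p, σ p⟩).2 + (t ⟨p, σ' p⟩).2 := by
          filter_upwards [hev] with p hp
          exact (t.linear ℝ hp).map_add _ _
        rw [hcongr h1, mvfderiv_fun_add (hdiff hσ) (hdiff hσ'),
          cov.isCovariantDerivativeOn.add hσ hσ' (Set.mem_univ _), ContinuousLinearMap.comp_add]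
        abel
      smul := by
        intro φ σ hφ hσ
        have h1 : (fun p => (t ⟨p, (φ • σ) p⟩).2) =ᶠ[nhds (f x)]
            fun p => φ p • (t ⟨p, σ p⟩).2 := by
          filter_upwards [hev] with p hp
          exact (t.linear ℝ hp).map_smul _ _
        have h3 : t.symmL ℝ (f x) (t ⟨f x, σ (f x)⟩).2 = σ (f x) := by
          rw [Trivialization.symmL_apply]
          · exact t.symm_apply_apply_mk hmem (σ (f x))
          · exact hmem
        rw [hcongr h1, mvfderiv_fun_smul hφ (hdiff hσ),
          cov.isCovariantDerivativeOn.leibniz hσ hφ (Set.mem_univ _)]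
        ext1 u
        simp only [add_apply, sub_apply, smul_apply, ContinuousLinearMap.comp_apply,
          ContinuousLinearMap.smulRight_apply, map_add, map_smul, h3, smul_sub]
        abel }
  have hext : MDiffAt (T% (FiberBundle.extend E (W (f x)))) (f x) :=
    FiberBundle.mdifferentiableAt_extend ..
  have hpt := hT.pointwise hW hext (FiberBundle.extend_apply_self (F := E) (W (f x))).symm
  have hconst : (fun p => (t ⟨p, FiberBundle.extend E (W (f x)) p⟩).2) =ᶠ[nhds (f x)]
      fun _ => (t ⟨f x, W (f x)⟩).2 := by
    filter_upwards [hev] with p hp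
    have h := congrArg Prod.snd (t.apply_mk_symm hp (t ⟨f x, W (f x)⟩).2)
    exact h
  have hchain : mvfderiv J (fun y : N => (t ⟨f y, W (f y)⟩).2) x v
      = mvfderiv I (fun p => (t ⟨p, W p⟩).2) (f x) (mfderiv J I f x v) := by
    have h := mfderiv_comp x (hdiff hW) hf
    exact congrArg (fun L => L v) h
  have h := congrArg (fun L => L (mfderiv J I f x v)) hpt
  rw [hcongr hconst] at h
  simp only [sub_apply, ContinuousLinearMap.comp_apply, mvfderiv_const, zero_apply, map_zero,
    sub_zero] at h
  rw [← hchain] at h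
  have hs : t.symmL ℝ (f x) (mvfderiv J (fun y : N => (t ⟨f y, W (f y)⟩).2) x v)
      = t.symm (f x) (mvfderiv J (fun y : N => (t ⟨f y, W (f y)⟩).2) x v) := by
    rw [Trivialization.symmL_apply]
    exact hmem
  rw [hs] at h
  rw [covAlong, ← h]
  exact add_sub_cancel _ _

variable (J) in
/-- The tangent space of the submanifold, as a subspace of the ambient tangent space. -/
def tangentOf (I : ModelWithCorners ℝ E H) (f : N → M) (x : N) :
    Submodule ℝ (TangentSpace I (f x)) :=
  LinearMap.range (mfderiv J I f x).toLinearMap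

/-- The image in the ambient tangent space of a subspace `W` tangent to the submanifold. -/
def push (I : ModelWithCorners ℝ E H) (f : N → M) {x : N}
    (W : Submodule ℝ (TangentSpace J x)) : Submodule ℝ (TangentSpace I (f x)) :=
  W.map (mfderiv J I f x).toLinearMap

/-- The bundle `F(D^⊥)`. -/
def imagePerp (gN : RiemMetric J N) (F : ∀ x : M, TangentSpace I x →L[ℝ] TangentSpace I x)
    (f : N → M) (D : ∀ x : N, Submodule ℝ (TangentSpace J x)) (x : N) :
    Submodule ℝ (TangentSpace I (f x)) :=
  (push I f (perp gN D x)).map (F (f x)).toLinearMap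

/-- The bundle `D̃`, the orthogonal complement of `F(D^⊥)` in the normal bundle. -/
def tildeD (g : RiemMetric I M) (gN : RiemMetric J N)
    (F : ∀ x : M, TangentSpace I x →L[ℝ] TangentSpace I x)
    (f : N → M) (D : ∀ x : N, Submodule ℝ (TangentSpace J x)) (x : N) :
    Submodule ℝ (TangentSpace I (f x)) :=
  gOrth g (tangentOf J I f x) ⊓ gOrth g (imagePerp gN F f D x)

/-- The submanifold is semi-invariant, with `F`-invariant distribution `D`: `F(D) ⊆ D`, `F(D^⊥)`
is normal to the submanifold, and `F²(D^⊥)` is a distribution on the submanifold. -/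
structure IsSemiInvariant (g : RiemMetric I M) (gN : RiemMetric J N)
    (F : ∀ x : M, TangentSpace I x →L[ℝ] TangentSpace I x)
    (f : N → M) (D : ∀ x : N, Submodule ℝ (TangentSpace J x)) : Prop where
  distribution : IsSmoothDistribution D
  invariant : ∀ x, (push I f (D x)).map (F (f x)).toLinearMap ≤ push I f (D x)
  anti_invariant : ∀ x, imagePerp gN F f D x ≤ gOrth g (tangentOf J I f x)
  sq_distribution : ∃ D' : ∀ x : N, Submodule ℝ (TangentSpace J x), IsSmoothDistribution D' ∧
    ∀ x, (imagePerp gN F f D x).map (F (f x)).toLinearMap = push I f (D' x)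

variable [FiniteDimensional ℝ E]

/-- The second fundamental form `h(X, Y)`: the normal part of the ambient `∇_X Y`. -/
def secondFundForm (g : RiemMetric I M) (f : N → M) (X Y : ∀ x : N, TangentSpace J x) (x : N) :
    TangentSpace I (f x) :=
  covAlong J (leviCivita g) f (fun y => mfderiv J I f y (Y y)) x (X x)
    - orthProj g (tangentOf J I f x)
        (covAlong J (leviCivita g) f (fun y => mfderiv J I f y (Y y)) x (X x))

/-- The Weingarten operator `A_V X`: minus the tangential part of the ambient `∇_X V`, where `V` is
a normal field; it is a vector tangent to the submanifold, viewed in the ambient tangent space. -/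
def weingarten (g : RiemMetric I M) (f : N → M) (V : ∀ x : N, TangentSpace I (f x))
    (X : ∀ x : N, TangentSpace J x) (x : N) : TangentSpace I (f x) :=
  -orthProj g (tangentOf J I f x) (covAlong J (leviCivita g) f V x (X x))

end Submanifold

end

/-!
Write `X` for sections of `D`, `Y` and `Z` for sections of `D^⊥`, and `∇` for the ambient connection
induced on vector fields along `f`. Each of the three conditions says that
`g(F Z, ∇_Y X) = 0` for all `X`, `Y`, `Z`.

* For (ii), `h(X, Y)` differs from `∇_Y X` by vectors tangent to `N`, because `∇` is torsion-free
  (`covAlong_torsion`), and `F Z` is normal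
  (`IsSemiInvariant.secondFundForm_mem_tildeD_iff`).
* For (iii), `g(A_V Y, X) = -g(∇_Y V, X) = g(V, ∇_Y X)` for a normal field `V`, because `∇` is metric
  (`inner_covAlong_normal`), and the values of `V` have the form `F Z`.
* For (i), the Gauss formula (`gauss_formula`), `F`-compatibility of `g` and `∇ F = 0` give
  `μ g(∇_Y Z, F X) = g(F Z, ∇_Y X)` (`IsSemiInvariant.inner_leviCivita`), and `F` maps `D` onto `D`.
  Involutivity follows from `[Y, Z] = ∇_Y Z - ∇_Z Y`.

To pass between sections and vectors, every vector of `D` or `D^⊥` has to extend to a global section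
(`IsSmoothDistribution.exists_section`). For `D^⊥` this uses that it is a smooth distribution, being
equal to `F²(D^⊥)` (`IsSemiInvariant.isSmoothDistribution_perp`).

The properties of the connection along `f` are deduced from those of the Levi-Civita connection of
`M`: near a point, a field along `f` is a combination of restrictions of ambient fields
(`MDiffAlongAt.induction`). The torsion identity is read off in a chart, from the fact that the Lie
bracket is the commutator of derivations (`mvfderiv_mlieBracket`).
-/

/-! ### Global extensions of local fields -/

section Extension
variable {E : Type*} [NormedAddCommGroup E] [NormedSpace ℝ E] [FiniteDimensional ℝ E]
  {H : Type*} [TopologicalSpace H] {I : ModelWithCorners ℝ E H}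
  {M : Type*} [TopologicalSpace M] [T2Space M] [ChartedSpace H M] [IsManifold I ∞ M]

/-- A bump function at `x` supported in `U` turns every field that is smooth on `U` into a global
smooth field with the same germ at `x`. -/
theorem exists_bump_smul_smoothField {U : Set M} (hU : IsOpen U) {x : M} (hx : x ∈ U) :
    ∃ χ : M → ℝ, χ =ᶠ[nhds x] (fun _ => 1) ∧ (∀ y ∉ U, χ y = 0) ∧
      ∀ Z : ∀ y : M, TangentSpace I y,
        ContMDiffOn I I.tangent ∞ (fun y => (⟨y, Z y⟩ : TangentBundle I M)) U →
          IsSmoothField (χ • Z) := by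
  obtain ⟨φ, -, hφ⟩ := (SmoothBumpFunction.nhds_basis_tsupport (I := I) x).mem_iff.1
    (hU.mem_nhds hx)
  refine ⟨φ, φ.eventuallyEq_one, fun y hy => ?_, fun Z hZ => ?_⟩
  · exact image_eq_zero_of_notMem_tsupport fun h => hy (hφ h)
  · exact ContMDiffOn.smul_section_of_tsupport φ.contMDiff.contMDiffOn hU hφ hZ

/-- Every vector of a smooth distribution is a value of one of its global sections. -/
theorem IsSmoothDistribution.exists_section {D : ∀ x : M, Submodule ℝ (TangentSpace I x)}
    (hD : IsSmoothDistribution D) {x : M} {v : TangentSpace I x} (hv : v ∈ D x) :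
    ∃ X : ∀ y : M, TangentSpace I y, IsSectionOf D X ∧ X x = v := by
  obtain ⟨U, k, X, hU, hx, hX, hspan⟩ := hD x
  obtain ⟨χ, hχ1, hχ0, hχ⟩ := exists_bump_smul_smoothField (I := I) hU hx
  rw [← (hspan x hx).2, Submodule.mem_span_range_iff_exists_fun] at hv
  obtain ⟨c, rfl⟩ := hv
  have hs : ContMDiffOn I I.tangent ∞
      (fun y => (⟨y, ∑ i, (fun _ : M => c i) y • X i y⟩ : TangentBundle I M)) U := by
    exact ContMDiffOn.sum_section (t := fun i => fun y => c i • X i y)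
      fun i _ => (contMDiffOn_const (c := c i)).smul_section (hX i)
  refine ⟨χ • fun y => ∑ i, c i • X i y, ⟨hχ _ hs, fun y => ?_⟩, ?_⟩
  · by_cases hy : y ∈ U
    · rw [← (hspan y hy).2]
      exact Submodule.smul_mem _ _ (Submodule.sum_mem _ fun i _ =>
        Submodule.smul_mem _ _ (Submodule.subset_span ⟨i, rfl⟩))
    · simp [hχ0 y hy]
  · simp [hχ1.eq_of_nhds]

end Extension

/-! ### The connection on vector fields along a map -/

section Along
variable {E : Type*} [NormedAddCommGroup E] [NormedSpace ℝ E]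
  {H : Type*} [TopologicalSpace H] {I : ModelWithCorners ℝ E H}
  {M : Type*} [TopologicalSpace M] [ChartedSpace H M] [IsManifold I ∞ M]
  {E' : Type*} [NormedAddCommGroup E'] [NormedSpace ℝ E']
  {H' : Type*} [TopologicalSpace H'] {J : ModelWithCorners ℝ E' H'}
  {N : Type*} [TopologicalSpace N] [ChartedSpace H' N]

variable (I J) in
/-- The vector field `V` along `f` is differentiable at `x`, as a map into the tangent bundle. In
particular `f` itself is differentiable at `x`. -/
def MDiffAlongAt (f : N → M) (V : ∀ y : N, TangentSpace I (f y)) (x : N) : Prop :=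
  MDifferentiableAt J I.tangent (fun y => (⟨f y, V y⟩ : TangentBundle I M)) x

theorem mvfderiv_congr {G : Type*} [NormedAddCommGroup G] [NormedSpace ℝ G] {h k : N → G} {x : N}
    (hk : h =ᶠ[nhds x] k) : mvfderiv J h x = mvfderiv J k x := by
  simp only [mvfderiv, hk.mfderiv_eq]
  rfl

theorem mdiffAlongAt_iff {f : N → M} {V : ∀ y : N, TangentSpace I (f y)} {x : N} :
    MDiffAlongAt I J f V x ↔ MDifferentiableAt J I f x ∧ MDifferentiableAt J 𝓘(ℝ, E)
      (fun y => (trivializationAt E (TangentSpace I : M → Type _) (f x) ⟨f y, V y⟩).2) x :=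
  mdifferentiableAt_totalSpace _ _

theorem trivializationAt_add {p q : M}
    (hq : q ∈ (trivializationAt E (TangentSpace I : M → Type _) p).baseSet)
    (v w : TangentSpace I q) :
    (trivializationAt E (TangentSpace I : M → Type _) p ⟨q, v + w⟩).2 =
      (trivializationAt E (TangentSpace I : M → Type _) p ⟨q, v⟩).2 +
      (trivializationAt E (TangentSpace I : M → Type _) p ⟨q, w⟩).2 :=
  ((trivializationAt E (TangentSpace I : M → Type _) p).linear ℝ hq).map_add v w

theorem trivializationAt_smul {p q : M}
    (hq : q ∈ (trivializationAt E (TangentSpace I : M → Type _) p).baseSet) (c : ℝ)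
    (v : TangentSpace I q) :
    (trivializationAt E (TangentSpace I : M → Type _) p ⟨q, c • v⟩).2 =
      c • (trivializationAt E (TangentSpace I : M → Type _) p ⟨q, v⟩).2 :=
  ((trivializationAt E (TangentSpace I : M → Type _) p).linear ℝ hq).map_smul c v

theorem eventually_mem_baseSet {f : N → M} {x : N} (hf : ContinuousAt f x) :
    ∀ᶠ y in nhds x, f y ∈ (trivializationAt E (TangentSpace I : M → Type _) (f x)).baseSet :=
  hf ((trivializationAt E (TangentSpace I : M → Type _) (f x)).open_baseSet.mem_nhds
    (FiberBundle.mem_baseSet_trivializationAt' (f x)))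

theorem MDiffAlongAt.add {f : N → M} {V W : ∀ y : N, TangentSpace I (f y)} {x : N}
    (hV : MDiffAlongAt I J f V x) (hW : MDiffAlongAt I J f W x) :
    MDiffAlongAt I J f (fun y => V y + W y) x := by
  rw [mdiffAlongAt_iff] at *
  refine ⟨hV.1, (hV.2.add hW.2).congr_of_eventuallyEq ?_⟩
  filter_upwards [eventually_mem_baseSet (I := I) hV.1.continuousAt] with y hy
  exact trivializationAt_add hy _ _

theorem MDiffAlongAt.smul {f : N → M} {a : N → ℝ} {V : ∀ y : N, TangentSpace I (f y)} {x : N}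
    (ha : MDiffAt a x) (hV : MDiffAlongAt I J f V x) :
    MDiffAlongAt I J f (fun y => a y • V y) x := by
  rw [mdiffAlongAt_iff] at *
  refine ⟨hV.1, (ha.smul hV.2).congr_of_eventuallyEq ?_⟩
  filter_upwards [eventually_mem_baseSet (I := I) hV.1.continuousAt] with y hy
  exact trivializationAt_smul hy _ _

theorem MDiffAlongAt.restrict {f : N → M} {W : ∀ p : M, TangentSpace I p} {x : N}
    (hf : MDiffAt f x) (hW : MDiffAt (T% W) (f x)) :
    MDiffAlongAt I J f (fun y => W (f y)) x :=
  hW.comp x hf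

theorem IsSmoothAlong.mdiffAlongAt {f : N → M} {V : ∀ y : N, TangentSpace I (f y)}
    (hV : IsSmoothAlong J f V) (x : N) : MDiffAlongAt I J f V x :=
  (hV x).mdifferentiableAt (by simp)

theorem covAlong_congr (cov : CovariantDerivative I E (TangentSpace I : M → Type _)) {f : N → M}
    {V W : ∀ y : N, TangentSpace I (f y)} {x : N} (h : ∀ᶠ y in nhds x, V y = W y)
    (v : TangentSpace J x) : covAlong J cov f V x v = covAlong J cov f W x v := by
  rw [covAlong, covAlong, h.self_of_nhds]
  congr 3
  exact mvfderiv_congr (h.mono fun y hy => by simp only [hy])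

theorem trivializationAt_symm_add {p q : M}
    (hq : q ∈ (trivializationAt E (TangentSpace I : M → Type _) p).baseSet) (v w : E) :
    (trivializationAt E (TangentSpace I : M → Type _) p).symm q (v + w) =
      (trivializationAt E (TangentSpace I : M → Type _) p).symm q v +
      (trivializationAt E (TangentSpace I : M → Type _) p).symm q w := by
  simp only [← Trivialization.coe_symmₗ (R := ℝ) _ hq, map_add]

theorem trivializationAt_symm_smul {p q : M}
    (hq : q ∈ (trivializationAt E (TangentSpace I : M → Type _) p).baseSet) (c : ℝ) (v : E) :
    (trivializationAt E (TangentSpace I : M → Type _) p).symm q (c • v) =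
      c • (trivializationAt E (TangentSpace I : M → Type _) p).symm q v := by
  simp only [← Trivialization.coe_symmₗ (R := ℝ) _ hq, map_smul]

/-- The local extensions `FiberBundle.extend` depend additively on the vector only inside the domain
of the trivialization, which is enough because `cov` is local. -/
theorem cov_extend_add (cov : CovariantDerivative I E (TangentSpace I : M → Type _)) (p : M)
    (v w : TangentSpace I p) :
    cov (FiberBundle.extend E (v + w)) p
      = cov (FiberBundle.extend E v) p + cov (FiberBundle.extend E w) p := by
  rw [← cov.isCovariantDerivativeOn.add (FiberBundle.mdifferentiableAt_extend ..)
    (FiberBundle.mdifferentiableAt_extend ..) (Set.mem_univ _)]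
  refine cov.isCovariantDerivativeOn.congr_of_eventuallyEq
    (FiberBundle.mdifferentiableAt_extend ..)
    (mdifferentiableAt_add_section (FiberBundle.mdifferentiableAt_extend ..)
      (FiberBundle.mdifferentiableAt_extend ..)) Filter.univ_mem ?_
  filter_upwards [eventually_mem_baseSet (I := I) (f := id) continuousAt_id] with q hq
  simp only [id_eq] at hq
  simp only [FiberBundle.extend, Pi.add_apply]
  rw [trivializationAt_add (FiberBundle.mem_baseSet_trivializationAt' p),
    trivializationAt_symm_add hq]

theorem cov_extend_smul (cov : CovariantDerivative I E (TangentSpace I : M → Type _)) (p : M)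
    (c : ℝ) (v : TangentSpace I p) :
    cov (FiberBundle.extend E (c • v)) p = c • cov (FiberBundle.extend E v) p := by
  have h := cov.isCovariantDerivativeOn.leibniz (g := fun _ : M => c)
    (FiberBundle.mdifferentiableAt_extend I E v) mdifferentiableAt_const (Set.mem_univ _)
  rw [mvfderiv_const, ContinuousLinearMap.zero_smulRight, add_zero] at h
  rw [← h]
  refine cov.isCovariantDerivativeOn.congr_of_eventuallyEq
    (FiberBundle.mdifferentiableAt_extend ..)
    (mdifferentiableAt_const.smul_section (FiberBundle.mdifferentiableAt_extend ..))
    Filter.univ_mem ?_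
  filter_upwards [eventually_mem_baseSet (I := I) (f := id) continuousAt_id] with q hq
  simp only [id_eq] at hq
  simp only [FiberBundle.extend, Pi.smul_apply']
  rw [trivializationAt_smul (FiberBundle.mem_baseSet_trivializationAt' p),
    trivializationAt_symm_smul hq]

theorem covAlong_add (cov : CovariantDerivative I E (TangentSpace I : M → Type _)) {f : N → M}
    {V W : ∀ y : N, TangentSpace I (f y)} {x : N} (hV : MDiffAlongAt I J f V x)
    (hW : MDiffAlongAt I J f W x) (v : TangentSpace J x) :
    covAlong J cov f (fun y => V y + W y) x v
      = covAlong J cov f V x v + covAlong J cov f W x v := by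
  rw [mdiffAlongAt_iff] at hV hW
  have h1 := mvfderiv_congr (J := J) ((eventually_mem_baseSet (I := I)
    hV.1.continuousAt).mono fun y hy => trivializationAt_add hy (V y) (W y))
  rw [mvfderiv_fun_add hV.2 hW.2] at h1
  simp only [covAlong]
  rw [h1, cov_extend_add, add_apply, add_apply]
  rw [trivializationAt_symm_add (FiberBundle.mem_baseSet_trivializationAt' (f x))]
  abel

/-- The Leibniz rule for the induced connection. -/
theorem covAlong_smul (cov : CovariantDerivative I E (TangentSpace I : M → Type _)) {f : N → M}
    {a : N → ℝ} {V : ∀ y : N, TangentSpace I (f y)} {x : N} (ha : MDiffAt a x)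
    (hV : MDiffAlongAt I J f V x) (v : TangentSpace J x) :
    covAlong J cov f (fun y => a y • V y) x v
      = a x • covAlong J cov f V x v + mvfderiv J a x v • V x := by
  rw [mdiffAlongAt_iff] at hV
  have hmem := FiberBundle.mem_baseSet_trivializationAt' (F := E)
    (E := (TangentSpace I : M → Type _)) (f x)
  have h1 := mvfderiv_congr (J := J) ((eventually_mem_baseSet (I := I)
    hV.1.continuousAt).mono fun y hy => trivializationAt_smul hy (a y) (V y))
  rw [mvfderiv_fun_smul ha hV.2] at h1
  simp only [covAlong]
  rw [h1, cov_extend_smul]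
  simp only [add_apply, smul_apply, ContinuousLinearMap.smulRight_apply]
  rw [trivializationAt_symm_add hmem, trivializationAt_symm_smul hmem,
    trivializationAt_symm_smul hmem, Trivialization.symm_apply_apply_mk _ hmem, smul_add]
  abel

end Along

/-! ### Metric and parallel tensors along a map -/

section AlongInduction
variable {E : Type*} [NormedAddCommGroup E] [NormedSpace ℝ E] [FiniteDimensional ℝ E]
  {H : Type*} [TopologicalSpace H] {I : ModelWithCorners ℝ E H}
  {M : Type*} [TopologicalSpace M] [T2Space M] [ChartedSpace H M] [IsManifold I ∞ M]
  {E' : Type*} [NormedAddCommGroup E'] [NormedSpace ℝ E']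
  {H' : Type*} [TopologicalSpace H'] {J : ModelWithCorners ℝ E' H'}
  {N : Type*} [TopologicalSpace N] [ChartedSpace H' N]

/-- Near a point, a vector field along `f` is a combination of restrictions of smooth ambient
vector fields; so a local property of fields along `f` that is stable under sums and under
multiplication by functions holds as soon as it holds for those restrictions. -/
theorem MDiffAlongAt.induction {f : N → M} {x : N}
    {P : (∀ y : N, TangentSpace I (f y)) → Prop}
    (restrict : ∀ W : ∀ p : M, TangentSpace I p, IsSmoothField W → P fun y => W (f y))
    (add : ∀ V W, MDiffAlongAt I J f V x → MDiffAlongAt I J f W x → P V → P W →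
      P fun y => V y + W y)
    (smul : ∀ (a : N → ℝ) (V), MDiffAt a x → MDiffAlongAt I J f V x → P V →
      P fun y => a y • V y)
    (congr : ∀ V W, MDiffAlongAt I J f V x → (∀ᶠ y in nhds x, V y = W y) → P V → P W)
    {V : ∀ y : N, TangentSpace I (f y)} (hV : MDiffAlongAt I J f V x) : P V := by
  classical
  obtain ⟨hf, hVt⟩ := mdiffAlongAt_iff.1 hV
  let t := trivializationAt E (TangentSpace I : M → Type _) (f x)
  have hmem : f x ∈ t.baseSet := FiberBundle.mem_baseSet_trivializationAt' (f x)
  let b := Module.finBasis ℝ E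
  obtain ⟨χ, hχ1, -, hχ⟩ := exists_bump_smul_smoothField (I := I) t.open_baseSet hmem
  have hW : ∀ i, IsSmoothField (χ • t.localFrame b i) := fun i =>
    hχ _ (t.contMDiffOn_localFrame_baseSet ∞ b i)
  -- The coefficients of `V` in the local frame; the frame itself is replaced by global fields.
  have ha : ∀ i, MDiffAt (fun y => b.coord i (t ⟨f y, V y⟩).2) x := fun i =>
    (LinearMap.toContinuousLinearMap (b.coord i)).differentiableAt.comp_mdifferentiableAt hVt
  have hsum : ∀ s : Finset (Fin (Module.finrank ℝ E)),
      MDiffAlongAt I J f (fun y => ∑ i ∈ s, b.coord i (t ⟨f y, V y⟩).2 •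
        (χ • t.localFrame b i) (f y)) x ∧
      P fun y => ∑ i ∈ s, b.coord i (t ⟨f y, V y⟩).2 • (χ • t.localFrame b i) (f y) := by
    have hr : ∀ W : ∀ p : M, TangentSpace I p, IsSmoothField W →
        MDiffAlongAt I J f (fun y => W (f y)) x := fun W hW =>
      MDiffAlongAt.restrict hf ((hW (f x)).mdifferentiableAt (by simp))
    intro s
    induction s using Finset.induction_on with
    | empty =>
      have h0 : IsSmoothField (0 : ∀ p : M, TangentSpace I p) :=
        contMDiff_zeroSection ℝ (TangentSpace I : M → Type _)
      simp only [Finset.sum_empty]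
      exact ⟨hr _ h0, restrict _ h0⟩
    | insert i s hi ih =>
      simp only [Finset.sum_insert hi]
      have h1 := MDiffAlongAt.smul (ha i) (hr _ (hW i))
      exact ⟨h1.add ih.1, add _ _ h1 ih.1 (smul _ _ (ha i) (hr _ (hW i)) (restrict _ (hW i))) ih.2⟩
  refine congr _ _ (hsum Finset.univ).1 ?_ (hsum Finset.univ).2
  filter_upwards [eventually_mem_baseSet (I := I) hf.continuousAt,
    hf.continuousAt.eventually hχ1] with y hy hy1
  simp only [Pi.smul_apply', hy1, one_smul]
  rw [← (t.basisAt b hy).sum_repr (V y)]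
  refine Finset.sum_congr rfl fun i _ => ?_
  rw [t.localFrame_apply_of_mem_baseSet b hy, (t.basisAt b hy).sum_repr (V y)]
  rfl

omit [FiniteDimensional ℝ E] [T2Space M] in
theorem mdifferentiableAt_metric_along (g : RiemMetric I M) {f : N → M}
    {V W : ∀ y : N, TangentSpace I (f y)} {x : N} (hV : MDiffAlongAt I J f V x)
    (hW : MDiffAlongAt I J f W x) : MDiffAt (fun y => g.inner (f y) (V y) (W y)) x := by
  have hf := (mdiffAlongAt_iff.1 hV).1
  have : MDifferentiableAt J (I.prod 𝓘(ℝ))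
      (fun y ↦ TotalSpace.mk' ℝ (E := Bundle.Trivial M ℝ) (f y)
        (g.inner (f y) (V y) (W y))) x := by
    apply MDifferentiableAt.clm_bundle_apply₂ (F₁ := E) (F₂ := E)
    · exact (g.contMDiff.mdifferentiableAt (by simp)).comp x hf
    · exact hV
    · exact hW
  simp only [mdifferentiableAt_totalSpace] at this
  exact this.2

variable [IsManifold J ∞ N]

/-- The induced connection on vector fields along `f` is compatible with the metric. -/
theorem metric_covAlong (g : RiemMetric I M) {f : N → M}
    {V W : ∀ y : N, TangentSpace I (f y)} {x : N} (hV : MDiffAlongAt I J f V x)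
    (hW : MDiffAlongAt I J f W x) (v : TangentSpace J x) :
    mvfderiv J (fun y => g.inner (f y) (V y) (W y)) x v
      = g.inner (f x) (covAlong J (leviCivita g) f V x v) (W x)
        + g.inner (f x) (V x) (covAlong J (leviCivita g) f W x v) := by
  have hf := (mdiffAlongAt_iff.1 hV).1
  have smooth : ∀ {X : ∀ p : M, TangentSpace I p}, IsSmoothField X → MDiffAt (T% X) (f x) :=
    fun hX => (hX (f x)).mdifferentiableAt (by simp)
  refine MDiffAlongAt.induction (P := fun V => mvfderiv J (fun y => g.inner (f y) (V y) (W y)) x v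
      = g.inner (f x) (covAlong J (leviCivita g) f V x v) (W x)
        + g.inner (f x) (V x) (covAlong J (leviCivita g) f W x v)) ?_ ?_ ?_ ?_ hV
  · intro X hX
    refine MDiffAlongAt.induction (P := fun W =>
      mvfderiv J (fun y => g.inner (f y) (X (f y)) (W y)) x v
        = g.inner (f x) (covAlong J (leviCivita g) f (fun y => X (f y)) x v) (W x)
          + g.inner (f x) (X (f x)) (covAlong J (leviCivita g) f W x v)) ?_ ?_ ?_ ?_ hW
    · intro Y hY
      rw [covAlong_comp _ _ hf (smooth hX), covAlong_comp _ _ hf (smooth hY),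
        ← (leviCivita_spec g).metric (smooth hX) (smooth hY)]
      exact congrArg (fun L => L v)
        (mfderiv_comp x (mdifferentiableAt_metric g (smooth hX) (smooth hY)) hf)
    · intro W W' hW hW' h h'
      have hX' := MDiffAlongAt.restrict hf (smooth hX)
      simp only [map_add, covAlong_add _ hW hW',
        mvfderiv_fun_add (mdifferentiableAt_metric_along g hX' hW)
          (mdifferentiableAt_metric_along g hX' hW'), add_apply, h, h']
      ring
    · intro a W ha hW h
      have hX' := MDiffAlongAt.restrict hf (smooth hX)
      simp only [map_smul, covAlong_smul _ ha hW, map_add, smul_eq_mul,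
        mvfderiv_fun_mul ha (mdifferentiableAt_metric_along g hX' hW), add_apply, smul_apply, h]
      ring
    · intro W W' _ hWW' h
      rw [← covAlong_congr _ hWW', ← hWW'.self_of_nhds, ← h]
      have hev : (fun y => g.inner (f y) (X (f y)) (W y)) =ᶠ[nhds x]
          fun y => g.inner (f y) (X (f y)) (W' y) := hWW'.mono fun y hy => by simp only [hy]
      rw [mvfderiv_congr hev]
  · intro V V' hV hV' h h'
    simp only [map_add, covAlong_add _ hV hV',
      mvfderiv_fun_add (mdifferentiableAt_metric_along g hV hW)
        (mdifferentiableAt_metric_along g hV' hW), add_apply, h, h']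
    ring
  · intro a V ha hV h
    simp only [map_smul, covAlong_smul _ ha hV, map_add, smul_eq_mul,
      mvfderiv_fun_mul ha (mdifferentiableAt_metric_along g hV hW), add_apply, smul_apply, h]
    ring
  · intro V V' _ hVV' h
    rw [← covAlong_congr _ hVV', ← hVV'.self_of_nhds, ← h]
    have hev : (fun y => g.inner (f y) (V y) (W y)) =ᶠ[nhds x]
        fun y => g.inner (f y) (V' y) (W y) := hVV'.mono fun y hy => by simp only [hy]
    rw [mvfderiv_congr hev]

omit [FiniteDimensional ℝ E] [T2Space M] [IsManifold J ∞ N] in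
theorem MDiffAlongAt.affinor {g : RiemMetric I M}
    {F : ∀ x : M, TangentSpace I x →L[ℝ] TangentSpace I x} {μ : ℝ} (hF : IsAffinorMetric g F μ)
    {f : N → M} {V : ∀ y : N, TangentSpace I (f y)} {x : N} (hV : MDiffAlongAt I J f V x) :
    MDiffAlongAt I J f (fun y => F (f y) (V y)) x := by
  have hf := (mdiffAlongAt_iff.1 hV).1
  exact MDifferentiableAt.clm_bundle_apply (F₁ := E) (F₂ := E) (b := f)
    ((hF.smooth.mdifferentiableAt (by simp)).comp x hf) hV

omit [FiniteDimensional ℝ E] [T2Space M] [IsManifold J ∞ N] in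
theorem IsSmoothAlong.affinor {g : RiemMetric I M}
    {F : ∀ x : M, TangentSpace I x →L[ℝ] TangentSpace I x} {μ : ℝ} (hF : IsAffinorMetric g F μ)
    {f : N → M} (hf : ContMDiff J I ∞ f) {V : ∀ y : N, TangentSpace I (f y)}
    (hV : IsSmoothAlong J f V) :
    IsSmoothAlong J f (fun y => F (f y) (V y)) :=
  ContMDiff.clm_bundle_apply (F₁ := E) (F₂ := E) (b := f) (hF.smooth.comp hf) hV

/-- A parallel tensor field commutes with the induced connection on vector fields along `f`. -/
theorem covAlong_affinor {g : RiemMetric I M}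
    {F : ∀ x : M, TangentSpace I x →L[ℝ] TangentSpace I x} {μ : ℝ} (hF : IsAffinorMetric g F μ)
    (hpar : IsParallel g F)
    {f : N → M} {V : ∀ y : N, TangentSpace I (f y)} {x : N} (hV : MDiffAlongAt I J f V x)
    (v : TangentSpace J x) :
    covAlong J (leviCivita g) f (fun y => F (f y) (V y)) x v
      = F (f x) (covAlong J (leviCivita g) f V x v) := by
  have hf := (mdiffAlongAt_iff.1 hV).1
  refine MDiffAlongAt.induction (P := fun V =>
    covAlong J (leviCivita g) f (fun y => F (f y) (V y)) x v
      = F (f x) (covAlong J (leviCivita g) f V x v)) ?_ ?_ ?_ ?_ hV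
  · intro X hX
    have hFX : IsSmoothField fun p => F p (X p) :=
      ContMDiff.clm_bundle_apply (F₁ := E) (F₂ := E) (b := id) hF.smooth hX
    rw [covAlong_comp _ _ hf ((hX (f x)).mdifferentiableAt (by simp)), ← hpar X hX]
    exact covAlong_comp _ _ hf ((hFX (f x)).mdifferentiableAt (by simp)) v
  · intro V V' hV hV' h h'
    simp only [map_add, covAlong_add _ hV hV', covAlong_add _ (hV.affinor hF) (hV'.affinor hF),
      h, h']
  · intro a V ha hV h
    simp only [map_smul, covAlong_smul _ ha hV, covAlong_smul _ ha (hV.affinor hF), map_add, h]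
  · intro V V' _ hVV' h
    rw [← covAlong_congr _ hVV', ← h]
    exact (covAlong_congr _ (hVV'.mono fun y hy => by simp only [hy]) v).symm

end AlongInduction

/-! ### The Lie bracket as a commutator -/

section Bracket
variable {E : Type*} [NormedAddCommGroup E] [NormedSpace ℝ E] [CompleteSpace E]
  {M : Type*} [TopologicalSpace M] [ChartedSpace E M] [IsManifold 𝓘(ℝ, E) ∞ M]
  {G : Type*} [NormedAddCommGroup G] [NormedSpace ℝ G]

/-- The Lie bracket of vector fields acts on functions as the commutator of derivations. -/
theorem mvfderiv_mlieBracket {u : M → G} {x : M} (hu : ContMDiffAt 𝓘(ℝ, E) 𝓘(ℝ, G) ∞ u x)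
    {X Y : ∀ y : M, TangentSpace 𝓘(ℝ, E) y} (hX : MDiffAt (T% X) x) (hY : MDiffAt (T% Y) x)
    (hXu : MDiffAt (fun y => mvfderiv 𝓘(ℝ, E) u y (X y)) x)
    (hYu : MDiffAt (fun y => mvfderiv 𝓘(ℝ, E) u y (Y y)) x) :
    mvfderiv 𝓘(ℝ, E) u x (mlieBracket 𝓘(ℝ, E) X Y x)
      = mvfderiv 𝓘(ℝ, E) (fun y => mvfderiv 𝓘(ℝ, E) u y (Y y)) x (X x)
        - mvfderiv 𝓘(ℝ, E) (fun y => mvfderiv 𝓘(ℝ, E) u y (X y)) x (Y x) := by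
  have : IsManifold 𝓘(ℝ, E) 2 M := IsManifold.of_le (n := ∞) (by norm_cast)
  have : IsManifold 𝓘(ℝ, E) 1 M := IsManifold.of_le (n := ∞) (by norm_cast)
  let φ := extChartAt 𝓘(ℝ, E) x
  have hφ : φ.symm (φ x) = x := extChartAt_to_inv x
  -- `P Z` is the field `Z` read in the chart at `x`.
  let P : (∀ y : M, TangentSpace 𝓘(ℝ, E) y) → E → E := fun Z =>
    mpullbackWithin 𝓘(ℝ, E) 𝓘(ℝ, E) φ.symm Z Set.univ
  have hP : ∀ {Z : ∀ y : M, TangentSpace 𝓘(ℝ, E) y}, MDiffAt (T% Z) x →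
      DifferentiableAt ℝ (P Z) (φ x) := by
    intro Z hZ
    rw [← mdifferentiableWithinAt_univ] at hZ
    have h := hZ.differentiableWithinAt_mpullbackWithin_vectorField
    rw [modelWithCornersSelf_coe, Set.range_id, Set.preimage_univ, Set.inter_univ] at h
    exact differentiableWithinAt_univ.1 h
  have hread : ∀ {h : M → G} (w : TangentSpace 𝓘(ℝ, E) x), MDiffAt h x →
      mvfderiv 𝓘(ℝ, E) h x w = fderiv ℝ (h ∘ φ.symm) (φ x) w := by
    intro h w hh
    rw [hh.mvfderiv, modelWithCornersSelf_coe, Set.range_id, fderivWithin_univ]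
    rfl
  have hsymm : ∀ {z : E}, z ∈ φ.target → MDifferentiableAt 𝓘(ℝ, E) 𝓘(ℝ, E) φ.symm z := by
    intro z hz
    have h := mdifferentiableWithinAt_extChartAt_symm (I := 𝓘(ℝ, E)) hz
    rwa [modelWithCornersSelf_coe, Set.range_id, mdifferentiableWithinAt_univ] at h
  have hinv : ∀ {z : E}, z ∈ φ.target →
      (mfderiv 𝓘(ℝ, E) 𝓘(ℝ, E) φ.symm z).IsInvertible := by
    intro z hz
    have h := isInvertible_mfderivWithin_extChartAt_symm (I := 𝓘(ℝ, E)) hz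
    rwa [modelWithCornersSelf_coe, Set.range_id, mfderivWithin_univ] at h
  have hcomm : ∀ Z : ∀ y : M, TangentSpace 𝓘(ℝ, E) y,
      (fun y => mvfderiv 𝓘(ℝ, E) u y (Z y)) ∘ φ.symm =ᶠ[nhds (φ x)]
        fun z => fderiv ℝ (u ∘ φ.symm) z (P Z z) := by
    intro Z
    have hu1 : ∀ᶠ y in nhds x, MDifferentiableAt 𝓘(ℝ, E) 𝓘(ℝ, G) u y :=
      ((contMDiffAt_iff_contMDiffAt_nhds (n := 1) (by simp)).1
        (hu.of_le (by norm_cast))).mono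
          fun y hy => hy.mdifferentiableAt (by simp)
    filter_upwards [extChartAt_target_mem_nhds (I := 𝓘(ℝ, E)) x,
      (continuousAt_extChartAt_symm (I := 𝓘(ℝ, E)) x).eventually
        (by rwa [extChartAt_to_inv x])] with z hz huz
    have h1 : ∀ w : TangentSpace 𝓘(ℝ, E) z, fderiv ℝ (u ∘ φ.symm) z w
        = mvfderiv 𝓘(ℝ, E) u (φ.symm z) (mfderiv 𝓘(ℝ, E) 𝓘(ℝ, E) φ.symm z w) := by
      intro w
      rw [← mfderiv_eq_fderiv]
      exact congrArg (fun L => L w) (mfderiv_comp z huz (hsymm hz))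
    refine Eq.trans ?_ (h1 _).symm
    simp only [P, mpullbackWithin_univ, mpullback_apply, Function.comp_apply]
    rw [(hinv hz).self_apply_inverse]
  have hPx : ∀ Z : ∀ y : M, TangentSpace 𝓘(ℝ, E) y, P Z (φ x) = Z x := by
    intro Z
    have h1 : (Z (φ.symm (φ x)) : E) = Z x := congrArg (fun y => (Z y : E)) hφ
    refine Eq.trans ?_ h1
    have h2 := mfderivWithin_range_extChartAt_symm (I := 𝓘(ℝ, E)) (x := x)
    rw [modelWithCornersSelf_coe, Set.range_id] at h2
    simp only [P, mpullbackWithin_apply]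
    exact (congrArg (fun L : E →L[ℝ] E => L.inverse (Z (φ.symm (φ x)))) h2).trans
      (congrArg (fun L : E →L[ℝ] E => L (Z (φ.symm (φ x)))) ContinuousLinearMap.inverse_id)
  have hbr : mlieBracket 𝓘(ℝ, E) X Y x = lieBracket ℝ (P X) (P Y) (φ x) := by
    rw [mlieBracket, mlieBracketWithin_apply, mfderiv_extChartAt_self,
      modelWithCornersSelf_coe, Set.range_id, Set.preimage_univ, Set.inter_univ]
    refine (congrArg (fun L : E →L[ℝ] E => L (lieBracketWithin ℝ (P X) (P Y) Set.univ (φ x)))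
      ContinuousLinearMap.inverse_id).trans ?_
    rw [lieBracketWithin_univ]
    rfl
  have hus : ContDiffAt ℝ ∞ (u ∘ φ.symm) (φ x) := by
    refine ContMDiffAt.contDiffAt ?_
    refine ContMDiffAt.comp (φ x) (by rwa [hφ]) ?_
    have h := contMDiffWithinAt_extChartAt_symm_range (I := 𝓘(ℝ, E)) (n := ∞) x
      (mem_extChartAt_target x)
    rwa [modelWithCornersSelf_coe, Set.range_id, contMDiffWithinAt_univ] at h
  have h := fderiv_apply_lieBracket hus (by simp; norm_cast) (hP hY) (hP hX)
  rw [hread _ (hu.mdifferentiableAt (by simp)), hbr, hread _ hXu, hread _ hYu,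
    (hcomm X).fderiv_eq, (hcomm Y).fderiv_eq, ← hPx X, ← hPx Y]
  exact h

end Bracket

/-! ### Torsion along a map -/

section Torsion
variable {E : Type*} [NormedAddCommGroup E] [NormedSpace ℝ E] [FiniteDimensional ℝ E]
  {M : Type*} [TopologicalSpace M] [ChartedSpace E M] [IsManifold 𝓘(ℝ, E) ∞ M]
  {E' : Type*} [NormedAddCommGroup E'] [NormedSpace ℝ E'] [FiniteDimensional ℝ E']
  {N : Type*} [TopologicalSpace N] [ChartedSpace E' N] [IsManifold 𝓘(ℝ, E') ∞ N]

omit [FiniteDimensional ℝ E] in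
/-- The fibre coordinate in the trivialization at `p` is the derivative of the chart at `p`. -/
theorem trivializationAt_eq_mvfderiv {p q : M}
    (hq : q ∈ (trivializationAt E (TangentSpace 𝓘(ℝ, E) : M → Type _) p).baseSet)
    (v : TangentSpace 𝓘(ℝ, E) q) :
    (trivializationAt E (TangentSpace 𝓘(ℝ, E) : M → Type _) p ⟨q, v⟩).2
      = mvfderiv 𝓘(ℝ, E) (extChartAt 𝓘(ℝ, E) p) q v := by
  have : IsManifold 𝓘(ℝ, E) 1 M := IsManifold.of_le (n := ∞) (by norm_cast)
  have h := TangentBundle.continuousLinearMapAt_trivializationAt (I := 𝓘(ℝ, E)) (x₀ := p) hq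
  rw [← Trivialization.continuousLinearMapAt_apply_of_mem (R := ℝ) _ hq]
  exact congrArg (fun L => L v) h

/-- The extensions `FiberBundle.extend` have constant coordinates in a chart, so they commute. -/
theorem mlieBracket_extend (p : M) (v w : TangentSpace 𝓘(ℝ, E) p) :
    mlieBracket 𝓘(ℝ, E) (FiberBundle.extend E v) (FiberBundle.extend E w) p = 0 := by
  let t := trivializationAt E (TangentSpace 𝓘(ℝ, E) : M → Type _) p
  have hmem : p ∈ t.baseSet := FiberBundle.mem_baseSet_trivializationAt' p
  have hconst : ∀ v : TangentSpace 𝓘(ℝ, E) p,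
      (fun q => mvfderiv 𝓘(ℝ, E) (extChartAt 𝓘(ℝ, E) p) q (FiberBundle.extend E v q))
        =ᶠ[nhds p] fun _ => (t ⟨p, v⟩).2 := by
    intro v
    filter_upwards [t.open_baseSet.mem_nhds hmem] with q hq
    rw [← trivializationAt_eq_mvfderiv hq]
    have h := congrArg Prod.snd (t.apply_mk_symm hq (t ⟨p, v⟩).2)
    exact h
  have hd : ∀ v : TangentSpace 𝓘(ℝ, E) p, MDiffAt
      (fun q => mvfderiv 𝓘(ℝ, E) (extChartAt 𝓘(ℝ, E) p) q (FiberBundle.extend E v q)) p :=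
    fun v => mdifferentiableAt_const.congr_of_eventuallyEq (hconst v)
  have h := mvfderiv_mlieBracket (contMDiffAt_extChartAt (I := 𝓘(ℝ, E)) (x := p))
    (FiberBundle.mdifferentiableAt_extend 𝓘(ℝ, E) E v)
    (FiberBundle.mdifferentiableAt_extend 𝓘(ℝ, E) E w) (hd v) (hd w)
  rw [mvfderiv_congr (hconst v), mvfderiv_congr (hconst w), mvfderiv_const, mvfderiv_const,
    zero_apply, zero_apply, sub_zero, ← trivializationAt_eq_mvfderiv hmem] at h
  rw [← t.symm_apply_apply_mk hmem (mlieBracket 𝓘(ℝ, E) _ _ p), h]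
  simpa using trivializationAt_symm_smul hmem 0 (0 : E)

omit [FiniteDimensional ℝ E] [FiniteDimensional ℝ E'] in
theorem IsSmoothField.isSmoothAlong_mfderiv {f : N → M} (hf : ContMDiff 𝓘(ℝ, E') 𝓘(ℝ, E) ∞ f)
    {X : ∀ y : N, TangentSpace 𝓘(ℝ, E') y} (hX : IsSmoothField X) :
    IsSmoothAlong 𝓘(ℝ, E') f (fun y => mfderiv 𝓘(ℝ, E') 𝓘(ℝ, E) f y (X y)) :=
  (hf.contMDiff_tangentMap (m := ∞) (by simp)).comp hX

/-- The connection that a torsion-free connection induces along `f` satisfies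
`∇_X (df Y) - ∇_Y (df X) = df [X, Y]`. -/
theorem covAlong_torsion {cov : CovariantDerivative 𝓘(ℝ, E) E (TangentSpace 𝓘(ℝ, E) : M → Type _)}
    (hcov : cov.torsion = 0) {f : N → M} (hf : ContMDiff 𝓘(ℝ, E') 𝓘(ℝ, E) ∞ f)
    {X Y : ∀ y : N, TangentSpace 𝓘(ℝ, E') y} (hX : IsSmoothField X) (hY : IsSmoothField Y)
    (x : N) :
    covAlong 𝓘(ℝ, E') cov f (fun y => mfderiv 𝓘(ℝ, E') 𝓘(ℝ, E) f y (Y y)) x (X x)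
      - covAlong 𝓘(ℝ, E') cov f (fun y => mfderiv 𝓘(ℝ, E') 𝓘(ℝ, E) f y (X y)) x (Y x)
      = mfderiv 𝓘(ℝ, E') 𝓘(ℝ, E) f x (mlieBracket 𝓘(ℝ, E') X Y x) := by
  let t := trivializationAt E (TangentSpace 𝓘(ℝ, E) : M → Type _) (f x)
  let u : N → E := extChartAt 𝓘(ℝ, E) (f x) ∘ f
  have hmem : f x ∈ t.baseSet := FiberBundle.mem_baseSet_trivializationAt' (f x)
  have hchain : ∀ {y : N}, f y ∈ t.baseSet → ∀ v : TangentSpace 𝓘(ℝ, E') y,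
      mvfderiv 𝓘(ℝ, E') u y v = (t ⟨f y, mfderiv 𝓘(ℝ, E') 𝓘(ℝ, E) f y v⟩).2 := by
    intro y hy v
    rw [trivializationAt_eq_mvfderiv hy]
    exact congrArg (fun L => L v) (mfderiv_comp y (mdifferentiableAt_extChartAt hy)
      (hf.mdifferentiableAt (by simp)))
  have hev : ∀ Z : ∀ y : N, TangentSpace 𝓘(ℝ, E') y, (fun y => mvfderiv 𝓘(ℝ, E') u y (Z y))
      =ᶠ[nhds x] fun y => (t ⟨f y, mfderiv 𝓘(ℝ, E') 𝓘(ℝ, E) f y (Z y)⟩).2 := by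
    intro Z
    filter_upwards [eventually_mem_baseSet (I := 𝓘(ℝ, E)) hf.continuous.continuousAt] with y hy
    exact hchain hy (Z y)
  have hd : ∀ {Z : ∀ y : N, TangentSpace 𝓘(ℝ, E') y}, IsSmoothField Z →
      MDiffAt (fun y => mvfderiv 𝓘(ℝ, E') u y (Z y)) x := fun {Z} hZ =>
    (mdiffAlongAt_iff.1 ((hZ.isSmoothAlong_mfderiv hf).mdiffAlongAt x)).2.congr_of_eventuallyEq
      (hev Z)
  have h1 := mvfderiv_mlieBracket
    (ContMDiffAt.comp x (contMDiffAt_extChartAt (I := 𝓘(ℝ, E)) (x := f x)) (hf x))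
    ((hX x).mdifferentiableAt (by simp)) ((hY x).mdifferentiableAt (by simp)) (hd hX) (hd hY)
  rw [hchain hmem, mvfderiv_congr (hev X), mvfderiv_congr (hev Y)] at h1
  have h2 := cov.torsion_eq_zero_iff.1 hcov
    (FiberBundle.mdifferentiableAt_extend 𝓘(ℝ, E) E
      (mfderiv 𝓘(ℝ, E') 𝓘(ℝ, E) f x (X x)))
    (FiberBundle.mdifferentiableAt_extend 𝓘(ℝ, E) E
      (mfderiv 𝓘(ℝ, E') 𝓘(ℝ, E) f x (Y x)))
  rw [mlieBracket_extend, FiberBundle.extend_apply_self, FiberBundle.extend_apply_self] at h2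
  rw [← t.symm_apply_apply_mk hmem (mfderiv 𝓘(ℝ, E') 𝓘(ℝ, E) f x (mlieBracket _ X Y x)), h1,
    sub_eq_add_neg (mvfderiv _ _ x (X x)), trivializationAt_symm_add hmem, ← neg_one_smul ℝ,
    trivializationAt_symm_smul hmem, neg_one_smul, covAlong, covAlong, ← sub_eq_add_neg,
    add_sub_add_comm, h2, add_zero]

end Torsion

/-! ### The Gauss formula -/

section Gauss
variable {E : Type*} [NormedAddCommGroup E] [NormedSpace ℝ E] [FiniteDimensional ℝ E]
  {M : Type*} [TopologicalSpace M] [T2Space M] [ChartedSpace E M] [IsManifold 𝓘(ℝ, E) ∞ M]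
  {E' : Type*} [NormedAddCommGroup E'] [NormedSpace ℝ E'] [FiniteDimensional ℝ E']
  {N : Type*} [TopologicalSpace N] [T2Space N] [ChartedSpace E' N] [IsManifold 𝓘(ℝ, E') ∞ N]

theorem exists_smoothField_eq {x : N} (v : TangentSpace 𝓘(ℝ, E') x) :
    ∃ X : ∀ y : N, TangentSpace 𝓘(ℝ, E') y, IsSmoothField X ∧ X x = v := by
  obtain ⟨s, hs, h⟩ := FiberBundle.exists_contMDiffOn_extend (k := ∞) 𝓘(ℝ, E') E' v
  obtain ⟨χ, hχ1, -, hχ⟩ := exists_bump_smul_smoothField (I := 𝓘(ℝ, E')) isOpen_interior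
    (mem_interior_iff_mem_nhds.2 hs)
  exact ⟨_, hχ _ (h.mono interior_subset), by simp [hχ1.eq_of_nhds]⟩

variable {g : RiemMetric 𝓘(ℝ, E) M} {gN : RiemMetric 𝓘(ℝ, E') N} {f : N → M}

/-- The Gauss formula: the Levi-Civita connection of the induced metric is the tangential part of
the ambient one. The difference of the two sides is symmetric in the first two of the three
fields and antisymmetric in the last two, hence zero. -/
theorem gauss_formula (hf : IsIsometricImmersion g gN f)
    {Y Z : ∀ y : N, TangentSpace 𝓘(ℝ, E') y} (hY : IsSmoothField Y) (hZ : IsSmoothField Z)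
    (x : N) (w : TangentSpace 𝓘(ℝ, E') x) :
    g.inner (f x) (covAlong 𝓘(ℝ, E') (leviCivita g) f (fun y => mfderiv% f y (Z y)) x (Y x))
      (mfderiv% f x w) = gN.inner x (leviCivita gN Z x (Y x)) w := by
  obtain ⟨X, hX, rfl⟩ := exists_smoothField_eq w
  have hd : ∀ {Z : ∀ y : N, TangentSpace 𝓘(ℝ, E') y}, IsSmoothField Z → MDiffAt (T% Z) x :=
    fun hZ => (hZ x).mdifferentiableAt (by simp)
  have ha : ∀ {Z : ∀ y : N, TangentSpace 𝓘(ℝ, E') y}, IsSmoothField Z →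
      MDiffAlongAt 𝓘(ℝ, E) 𝓘(ℝ, E') f (fun y => mfderiv% f y (Z y)) x :=
    fun hZ => (hZ.isSmoothAlong_mfderiv hf.smooth).mdiffAlongAt x
  have tor : ∀ {A B C : ∀ y : N, TangentSpace 𝓘(ℝ, E') y}, IsSmoothField A → IsSmoothField B →
      g.inner (f x) (covAlong 𝓘(ℝ, E') (leviCivita g) f (fun y => mfderiv% f y (B y)) x (A x))
        (mfderiv% f x (C x)) - gN.inner x (leviCivita gN B x (A x)) (C x)
      = g.inner (f x) (covAlong 𝓘(ℝ, E') (leviCivita g) f (fun y => mfderiv% f y (A y)) x (B x))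
        (mfderiv% f x (C x)) - gN.inner x (leviCivita gN A x (B x)) (C x) := by
    intro A B C hA hB
    have h1 := covAlong_torsion (leviCivita_spec g).torsion_free hf.smooth hA hB x
    have h2 := (leviCivita gN).torsion_eq_zero_iff.1 (leviCivita_spec gN).torsion_free
      (hd hA) (hd hB)
    have h3 := hf.isometric x (mlieBracket 𝓘(ℝ, E') A B x) (C x)
    rw [← h1, ← h2] at h3
    simp only [map_sub, sub_apply] at h3
    linarith
  have met : ∀ {A B C : ∀ y : N, TangentSpace 𝓘(ℝ, E') y}, IsSmoothField B → IsSmoothField C →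
      g.inner (f x) (covAlong 𝓘(ℝ, E') (leviCivita g) f (fun y => mfderiv% f y (B y)) x (A x))
        (mfderiv% f x (C x)) - gN.inner x (leviCivita gN B x (A x)) (C x)
      = -(g.inner (f x) (covAlong 𝓘(ℝ, E') (leviCivita g) f (fun y => mfderiv% f y (C y)) x (A x))
        (mfderiv% f x (B x)) - gN.inner x (leviCivita gN C x (A x)) (B x)) := by
    intro A B C hB hC
    have h1 := metric_covAlong g (ha hB) (ha hC) (A x)
    have h2 := (leviCivita_spec gN).metric (hd hB) (hd hC) (A x)
    simp only [hf.isometric] at h2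
    rw [h1] at h2
    rw [g.symm _ _ (covAlong _ _ _ _ _ _), ← hf.isometric, ← hf.isometric,
      gN.symm x (B x)] at h2
    linarith
  have e1 := met (A := Y) hZ hX
  have e2 := tor (C := Z) hY hX
  have e3 := met (A := X) hY hZ
  have e4 := tor (C := Y) hX hZ
  have e5 := met (A := Z) hX hY
  have e6 := tor (C := X) hZ hY
  linarith

end Gauss

/-! ### Semi-invariant submanifolds -/

section SemiInvariant
variable {E : Type*} [NormedAddCommGroup E] [NormedSpace ℝ E] [FiniteDimensional ℝ E]
  {M : Type*} [TopologicalSpace M] [ChartedSpace E M] [IsManifold 𝓘(ℝ, E) ∞ M]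
  {E' : Type*} [NormedAddCommGroup E'] [NormedSpace ℝ E'] [FiniteDimensional ℝ E']
  {N : Type*} [TopologicalSpace N] [ChartedSpace E' N] [IsManifold 𝓘(ℝ, E') ∞ N]
  {g : RiemMetric 𝓘(ℝ, E) M}
  {F : ∀ x : M, TangentSpace 𝓘(ℝ, E) x →L[ℝ] TangentSpace 𝓘(ℝ, E) x} {μ : ℝ}
  {gN : RiemMetric 𝓘(ℝ, E') N} {f : N → M}
  {D : ∀ x : N, Submodule ℝ (TangentSpace 𝓘(ℝ, E') x)}

omit [FiniteDimensional ℝ E] [IsManifold 𝓘(ℝ, E) ∞ M] [FiniteDimensional ℝ E'] in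
theorem mem_imagePerp {x : N} {z : TangentSpace 𝓘(ℝ, E') x} (hz : z ∈ perp gN D x) :
    F (f x) (mfderiv% f x z) ∈ imagePerp gN F f D x :=
  ⟨_, ⟨z, hz, rfl⟩, rfl⟩

omit [FiniteDimensional ℝ E] [FiniteDimensional ℝ E'] in
theorem IsSemiInvariant.inner_eq_zero (hD : IsSemiInvariant g gN F f D) {x : N}
    {z : TangentSpace 𝓘(ℝ, E') x} (hz : z ∈ perp gN D x) (w : TangentSpace 𝓘(ℝ, E') x) :
    g.inner (f x) (F (f x) (mfderiv% f x z)) (mfderiv% f x w) = 0 :=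
  hD.anti_invariant x (mem_imagePerp hz) _ ⟨w, rfl⟩

omit [FiniteDimensional ℝ E] [FiniteDimensional ℝ E'] in
theorem IsSemiInvariant.exists_image (hD : IsSemiInvariant g gN F f D) {x : N}
    {w : TangentSpace 𝓘(ℝ, E') x} (hw : w ∈ D x) :
    ∃ w' ∈ D x, mfderiv% f x w' = F (f x) (mfderiv% f x w) :=
  hD.invariant x ⟨_, ⟨w, hw, rfl⟩, rfl⟩

omit [FiniteDimensional ℝ E'] in
/-- `F` maps `D` onto `D`, being injective. -/
theorem IsSemiInvariant.exists_preimage (hD : IsSemiInvariant g gN F f D)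
    (hF : ∀ x, Function.Injective (F x)) {x : N}
    {w : TangentSpace 𝓘(ℝ, E') x} (hw : w ∈ D x) :
    ∃ w' ∈ D x, F (f x) (mfderiv% f x w') = mfderiv% f x w := by
  have : FiniteDimensional ℝ (TangentSpace 𝓘(ℝ, E) (f x)) := inferInstanceAs (FiniteDimensional ℝ E)
  have heq := Submodule.eq_of_le_of_finrank_eq (hD.invariant x)
    (Submodule.equivMapOfInjective (F (f x)).toLinearMap (hF (f x)) (push _ f (D x))).finrank_eq.symm
  have hw' : mfderiv% f x w ∈ push 𝓘(ℝ, E) f (D x) := ⟨w, hw, rfl⟩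
  rw [← heq] at hw'
  obtain ⟨_, ⟨w', h, rfl⟩, h'⟩ := hw'
  exact ⟨w', h, h'⟩

omit [FiniteDimensional ℝ E] in
/-- The bundle `D^⊥` is a smooth distribution: it is equal to the distribution `F²(D^⊥)`, which is
orthogonal to `D` and has the same rank. -/
theorem IsSemiInvariant.isSmoothDistribution_perp (hD : IsSemiInvariant g gN F f D)
    (hf : IsIsometricImmersion g gN f) (hF : IsAffinorMetric g F μ)
    (hinj : ∀ x, Function.Injective (F x)) : IsSmoothDistribution (perp gN D) := by
  obtain ⟨D', hD', h⟩ := hD.sq_distribution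
  suffices D' = perp gN D from this ▸ hD'
  funext x
  have : FiniteDimensional ℝ (TangentSpace 𝓘(ℝ, E') x) := inferInstanceAs (FiniteDimensional ℝ E')
  refine Submodule.eq_of_le_of_finrank_eq (fun v hv => ?_) ?_
  · have hv' : mfderiv% f x v ∈ push 𝓘(ℝ, E) f (D' x) := ⟨v, hv, rfl⟩
    rw [← h x] at hv'
    obtain ⟨_, ⟨_, ⟨z, hz, rfl⟩, rfl⟩, hzv⟩ := hv'
    intro w hw
    obtain ⟨w', -, hw'⟩ := hD.exists_image hw
    have h1 := hF.compat (f x) (F (f x) (mfderiv% f x z)) (mfderiv% f x w)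
    rw [← hw', hD.inner_eq_zero hz, mul_zero, add_zero] at h1
    rw [hf.isometric, ← h1, ← hzv]
    rfl
  · have h1 : ∀ W : Submodule ℝ (TangentSpace 𝓘(ℝ, E') x),
        Module.finrank ℝ W = Module.finrank ℝ (push 𝓘(ℝ, E) f W) := fun W =>
      (Submodule.equivMapOfInjective (mfderiv% f x).toLinearMap (hf.injective x) W).finrank_eq
    have h2 : ∀ W : Submodule ℝ (TangentSpace 𝓘(ℝ, E) (f x)),
        Module.finrank ℝ W = Module.finrank ℝ (W.map (F (f x)).toLinearMap) := fun W =>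
      (Submodule.equivMapOfInjective (F (f x)).toLinearMap (hinj (f x)) W).finrank_eq
    rw [h1 (D' x), ← h x, ← h2, imagePerp, ← h2, ← h1]

variable [T2Space M] [T2Space N]

omit [FiniteDimensional ℝ E'] [T2Space N] in
/-- For `X` tangent to `N` and a normal field `V` along `f`, `g(∇_Y V, X) = -g(V, ∇_Y X)`. -/
theorem inner_covAlong_normal (hf : ContMDiff 𝓘(ℝ, E') 𝓘(ℝ, E) ∞ f)
    {V : ∀ y : N, TangentSpace 𝓘(ℝ, E) (f y)} (hV : IsSmoothAlong 𝓘(ℝ, E') f V)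
    {X : ∀ y : N, TangentSpace 𝓘(ℝ, E') y} (hX : IsSmoothField X)
    (hVX : ∀ y, g.inner (f y) (V y) (mfderiv% f y (X y)) = 0) (x : N)
    (v : TangentSpace 𝓘(ℝ, E') x) :
    g.inner (f x) (covAlong 𝓘(ℝ, E') (leviCivita g) f V x v) (mfderiv% f x (X x))
      = -g.inner (f x) (V x)
          (covAlong 𝓘(ℝ, E') (leviCivita g) f (fun y => mfderiv% f y (X y)) x v) := by
  have h := metric_covAlong g (hV.mdiffAlongAt x)
    ((hX.isSmoothAlong_mfderiv hf).mdiffAlongAt x) v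
  simp only [hVX, mvfderiv_const, zero_apply] at h
  linarith

omit [T2Space M] [T2Space N] in
/-- `h(X, Y)` lies in `D̃` exactly when `∇_Y X` is orthogonal to `F(D^⊥)`. -/
theorem IsSemiInvariant.secondFundForm_mem_tildeD_iff (hD : IsSemiInvariant g gN F f D)
    (hf : ContMDiff 𝓘(ℝ, E') 𝓘(ℝ, E) ∞ f)
    {X Y : ∀ y : N, TangentSpace 𝓘(ℝ, E') y} (hX : IsSmoothField X) (hY : IsSmoothField Y)
    (x : N) :
    secondFundForm g f X Y x ∈ tildeD g gN F f D x ↔ ∀ z ∈ perp gN D x,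
      g.inner (f x) (F (f x) (mfderiv% f x z))
        (covAlong 𝓘(ℝ, E') (leviCivita g) f (fun y => mfderiv% f y (X y)) x (Y x)) = 0 := by
  have htor := covAlong_torsion (leviCivita_spec g).torsion_free hf hX hY x
  have hspec := orthProj_spec g (tangentOf 𝓘(ℝ, E') 𝓘(ℝ, E) f x)
    (covAlong 𝓘(ℝ, E') (leviCivita g) f (fun y => mfderiv% f y (Y y)) x (X x))
  have key : ∀ z ∈ perp gN D x, g.inner (f x) (secondFundForm g f X Y x)
      (F (f x) (mfderiv% f x z)) = g.inner (f x) (F (f x) (mfderiv% f x z))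
        (covAlong 𝓘(ℝ, E') (leviCivita g) f (fun y => mfderiv% f y (X y)) x (Y x)) := by
    intro z hz
    obtain ⟨u, hu⟩ := hspec.1
    rw [g.symm, secondFundForm, map_sub, ← hu, sub_eq_iff_eq_add.1 htor, map_add]
    have h1 := hD.inner_eq_zero hz u
    have h2 := hD.inner_eq_zero hz (mlieBracket 𝓘(ℝ, E') X Y x)
    change _ - g.inner (f x) _ (mfderiv% f x u) = _
    rw [h1, h2]
    ring
  constructor
  · intro h z hz
    rw [← key z hz]
    exact h.2 _ (mem_imagePerp hz)
  · refine fun h => ⟨hspec.2, ?_⟩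
    rintro _ ⟨_, ⟨z, hz, rfl⟩, rfl⟩
    exact (key z hz).trans (h z hz)

omit [FiniteDimensional ℝ E'] [T2Space M] [T2Space N] in
/-- `A_V Y` lies in `D^⊥` exactly when it is orthogonal to `D`. -/
theorem weingarten_mem_push_perp_iff (hf : IsIsometricImmersion g gN f)
    (V : ∀ y : N, TangentSpace 𝓘(ℝ, E) (f y)) (Y : ∀ y : N, TangentSpace 𝓘(ℝ, E') y) (x : N) :
    weingarten g f V Y x ∈ push 𝓘(ℝ, E) f (perp gN D x) ↔ ∀ w ∈ D x,
      g.inner (f x) (covAlong 𝓘(ℝ, E') (leviCivita g) f V x (Y x)) (mfderiv% f x w) = 0 := by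
  have hspec := orthProj_spec g (tangentOf 𝓘(ℝ, E') 𝓘(ℝ, E) f x)
    (covAlong 𝓘(ℝ, E') (leviCivita g) f V x (Y x))
  obtain ⟨u, hu⟩ := hspec.1
  have hu' : mfderiv% f x u = orthProj g (tangentOf 𝓘(ℝ, E') 𝓘(ℝ, E) f x)
    (covAlong 𝓘(ℝ, E') (leviCivita g) f V x (Y x)) := hu
  have key : ∀ w, g.inner (f x) (covAlong 𝓘(ℝ, E') (leviCivita g) f V x (Y x)) (mfderiv% f x w)
      = gN.inner x u w := by
    intro w
    have h := hspec.2 _ ⟨w, rfl⟩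
    rw [← hu', map_sub, sub_apply, sub_eq_zero] at h
    rw [hf.isometric]
    exact h
  simp only [key]
  rw [weingarten, ← hu', ← map_neg]
  constructor
  · rintro ⟨z, hz, hzu⟩ w hw
    have h := hz w hw
    rw [hf.injective x hzu, metric_neg_left, neg_eq_zero] at h
    exact h
  · exact fun h => ⟨-u, fun w hw => by rw [metric_neg_left, h w hw, neg_zero], rfl⟩

/-- For `X` in `D` and `Y`, `Z` in `D^⊥`, the component of `∇_Y Z` along `F X` is, up to the
sign `μ`, the component of `∇_Y X` along the normal field `F Z`. -/
theorem IsSemiInvariant.inner_leviCivita (hD : IsSemiInvariant g gN F f D)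
    (hf : IsIsometricImmersion g gN f) (hF : IsAffinorMetric g F μ) (hpar : IsParallel g F)
    {X Y Z : ∀ y : N, TangentSpace 𝓘(ℝ, E') y} (hX : IsSmoothField X) (hY : IsSmoothField Y)
    (hZ : IsSectionOf (perp gN D) Z) {x : N} {w : TangentSpace 𝓘(ℝ, E') x}
    (hw : mfderiv% f x w = F (f x) (mfderiv% f x (X x))) :
    μ * gN.inner x (leviCivita gN Z x (Y x)) w
      = g.inner (f x) (F (f x) (mfderiv% f x (Z x)))
        (covAlong 𝓘(ℝ, E') (leviCivita g) f (fun y => mfderiv% f y (X y)) x (Y x)) := by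
  have hZf := hZ.smooth.isSmoothAlong_mfderiv hf.smooth
  have h1 := inner_covAlong_normal (g := g) hf.smooth (hZf.affinor hF hf.smooth) hX
    (fun y => hD.inner_eq_zero (hZ.mem y) (X y)) x (Y x)
  rw [covAlong_affinor hF hpar (hZf.mdiffAlongAt x)] at h1
  rw [← gauss_formula hf hY hZ.smooth, hw]
  linarith [hF.compat (f x)
    (covAlong 𝓘(ℝ, E') (leviCivita g) f (fun y => mfderiv% f y (Z y)) x (Y x))
    (mfderiv% f x (X x))]

end SemiInvariant

/-! ### The equivalence -/

theorem theorem4p8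
    {E : Type*} [NormedAddCommGroup E] [NormedSpace ℝ E] [FiniteDimensional ℝ E]
    {M : Type*} [TopologicalSpace M] [T2Space M] [SecondCountableTopology M]
    [ChartedSpace E M] [IsManifold 𝓘(ℝ, E) ∞ M]
    {E' : Type*} [NormedAddCommGroup E'] [NormedSpace ℝ E'] [FiniteDimensional ℝ E']
    {N : Type*} [TopologicalSpace N] [T2Space N] [SecondCountableTopology N]
    [ChartedSpace E' N] [IsManifold 𝓘(ℝ, E') ∞ N]
    -- the nondegenerate `(g, F, μ)`-manifold `M` with parallel tensor field `F`
    (g : RiemMetric 𝓘(ℝ, E) M)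
    (F : ∀ x : M, TangentSpace 𝓘(ℝ, E) x →L[ℝ] TangentSpace 𝓘(ℝ, E) x) (μ : ℝ)
    (hF : IsAffinorMetric g F μ)
    (hnondeg : ∀ x : M, Function.Bijective (F x))
    (hparallel : IsParallel g F)
    -- the submanifold `N` with its induced metric
    (gN : RiemMetric 𝓘(ℝ, E') N) (f : N → M) (hf : IsIsometricImmersion g gN f)
    -- which is semi-invariant, with `F`-invariant distribution `D`
    (D : ∀ x : N, Submodule ℝ (TangentSpace 𝓘(ℝ, E') x))
    (hD : IsSemiInvariant g gN F f D) :
    List.TFAE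
      [ IsTotallyGeodesicFoliation gN (perp gN D),
        ∀ X Y : ∀ x : N, TangentSpace 𝓘(ℝ, E') x,
          IsSectionOf D X → IsSectionOf (perp gN D) Y →
            ∀ x, secondFundForm g f X Y x ∈ tildeD g gN F f D x,
        ∀ V : ∀ x : N, TangentSpace 𝓘(ℝ, E) (f x),
          IsSmoothAlong 𝓘(ℝ, E') f V → (∀ x, V x ∈ imagePerp gN F f D x) →
            ∀ Y : ∀ x : N, TangentSpace 𝓘(ℝ, E') x, IsSectionOf (perp gN D) Y →
              ∀ x, weingarten g f V Y x ∈ push 𝓘(ℝ, E) f (perp gN D x) ] := by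
  have hinj : ∀ x, Function.Injective (F x) := fun x => (hnondeg x).injective
  have hμ : μ ≠ 0 := by
    rcases hF.sign with h | h <;> rw [h] <;> norm_num
  have hDperp := hD.isSmoothDistribution_perp hf hF hinj
  -- Each of the three conditions is equivalent to the vanishing of `g(F Z, ∇_Y X)`.
  let K : Prop := ∀ X Y Z : ∀ x : N, TangentSpace 𝓘(ℝ, E') x, IsSectionOf D X →
    IsSectionOf (perp gN D) Y → IsSectionOf (perp gN D) Z → ∀ x,
      g.inner (f x) (F (f x) (mfderiv% f x (Z x)))
        (covAlong 𝓘(ℝ, E') (leviCivita g) f (fun y => mfderiv% f y (X y)) x (Y x)) = 0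
  have h1 : IsTotallyGeodesicFoliation gN (perp gN D) ↔ K := by
    constructor
    · intro h X Y Z hX hY hZ x
      obtain ⟨w, hw, hwX⟩ := hD.exists_image (hX.mem x)
      rw [← hD.inner_leviCivita hf hF hparallel hX.smooth hY.smooth hZ hwX,
        h.geodesic Y Z hY hZ x w hw, mul_zero]
    · intro h
      have hgeo : ∀ Y Z : ∀ x : N, TangentSpace 𝓘(ℝ, E') x, IsSectionOf (perp gN D) Y →
          IsSectionOf (perp gN D) Z → ∀ x, leviCivita gN Z x (Y x) ∈ perp gN D x := by
        intro Y Z hY hZ x w hw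
        obtain ⟨w', hw', hww'⟩ := hD.exists_preimage hinj hw
        obtain ⟨X, hX, rfl⟩ := hD.distribution.exists_section hw'
        have h2 := hD.inner_leviCivita hf hF hparallel hX.smooth hY.smooth hZ hww'.symm
        rw [h X Y Z hX hY hZ x] at h2
        exact (mul_eq_zero.1 h2).resolve_left hμ
      refine ⟨fun Y Z hY hZ x => ?_, hgeo⟩
      rw [← (leviCivita gN).torsion_eq_zero_iff.1 (leviCivita_spec gN).torsion_free
        ((hY.smooth x).mdifferentiableAt (by simp)) ((hZ.smooth x).mdifferentiableAt (by simp))]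
      exact Submodule.sub_mem _ (hgeo Y Z hY hZ x) (hgeo Z Y hZ hY x)
  have h2 : (∀ X Y : ∀ x : N, TangentSpace 𝓘(ℝ, E') x,
      IsSectionOf D X → IsSectionOf (perp gN D) Y →
        ∀ x, secondFundForm g f X Y x ∈ tildeD g gN F f D x) ↔ K := by
    constructor
    · intro h X Y Z hX hY hZ x
      exact (hD.secondFundForm_mem_tildeD_iff hf.smooth hX.smooth hY.smooth x).1
        (h X Y hX hY x) _ (hZ.mem x)
    · intro h X Y hX hY x
      refine (hD.secondFundForm_mem_tildeD_iff hf.smooth hX.smooth hY.smooth x).2 fun z hz => ?_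
      obtain ⟨Z, hZ, rfl⟩ := hDperp.exists_section hz
      exact h X Y Z hX hY hZ x
  have h3 : (∀ V : ∀ x : N, TangentSpace 𝓘(ℝ, E) (f x),
      IsSmoothAlong 𝓘(ℝ, E') f V → (∀ x, V x ∈ imagePerp gN F f D x) →
        ∀ Y : ∀ x : N, TangentSpace 𝓘(ℝ, E') x, IsSectionOf (perp gN D) Y →
          ∀ x, weingarten g f V Y x ∈ push 𝓘(ℝ, E) f (perp gN D x)) ↔ K := by
    constructor
    · intro h X Y Z hX hY hZ x
      have hV := (hZ.smooth.isSmoothAlong_mfderiv hf.smooth).affinor hF hf.smooth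
      have h4 := (weingarten_mem_push_perp_iff hf _ Y x).1
        (h _ hV (fun y => mem_imagePerp (hZ.mem y)) Y hY x) (X x) (hX.mem x)
      rw [inner_covAlong_normal hf.smooth hV hX.smooth
        (fun y => hD.inner_eq_zero (hZ.mem y) (X y))] at h4
      exact neg_eq_zero.1 h4
    · intro h V hV hVmem Y hY x
      refine (weingarten_mem_push_perp_iff hf V Y x).2 fun w hw => ?_
      obtain ⟨X, hX, rfl⟩ := hD.distribution.exists_section hw
      rw [inner_covAlong_normal hf.smooth hV hX.smooth
        (fun y => hD.anti_invariant y (hVmem y) _ ⟨X y, rfl⟩), neg_eq_zero]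
      obtain ⟨_, ⟨z, hz, rfl⟩, hzV⟩ := hVmem x
      obtain ⟨Z, hZ, rfl⟩ := hDperp.exists_section hz
      rw [← hzV]
      exact h X Y Z hX hY hZ x
  tfae_have 1 ↔ 2 := h1.trans h2.symm
  tfae_have 2 ↔ 3 := h2.trans h3.symm
  tfae_finish
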